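/- Let $k$ be a field of characteristic different from $2$ with separable closure $k^s$, let $n\ge 2$ be even, and let $f(x,y)=f_0x^n+f_1x^{n-1}y+\cdots+f_ny^n$ be a binary form over $k$ with $f_0\neq 0$ and discriminant $\Delta(f)\ne 0$. Write $f(x,1)=f_0\,g(x)$ with $g$ monic and let $L=k[x]/(g)=k[\beta]$. The groups $G=\mathrm{SL}_n$ and $H=\mathrm{SL}_n/\mu_2$ act on the space $V$ of pairs $(A,B)$ of symmetric bilinear forms in $n$ variables by $(g\cdot A)(w,w')=A(g^{-1}w,g^{-1}w')$, and likewise for $B$; for a $k$-algebra $E$ let $V_f(E)$ be the set of pairs over $E$ with $(-1)^{n(n-1)/2}\det(xA-yB)=f(x,y)$. Put $R=\mathrm{Res}_{L/k}\mu_2$ and $R_0=(\mathrm{Res}_{L/k}\mu_2)_{N=1}$, the kernel of the norm $N:R\to\mu_2$. For a group $M=G$ or $H$ let $M_f$ be the commutative group with $\mathrm{Gal}(k^s/k)$-action obtained by descent from the stabilizers: its elements are the families $(b_v)_{v\in V_f(k^s)}$ with $b_v\in M(k^s)$ fixing $v$ and $b_{hv}=hb_vh^{-1}$ for all $h\in M(k^s)$,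 with $({}^\sigma b)_{{}^\sigma v}={}^\sigma(b_v)$. Let $d_f^M\in H^2(k,M_f)$ be the class of the 2-cocycle $d_{\sigma,\tau}$ with $(d_{\sigma,\tau})_v=g_\sigma\,{}^\sigma g_\tau\,g_{\sigma\tau}^{-1}$, where $v\in V_f(k^s)$ and $\sigma\mapsto g_\sigma\in M(k^s)$ is a continuous choice of elements with $g_\sigma\,{}^\sigma v=v$. Then: 1. For every $v=(A,B)\in V_f(k^s)$, with $T=A^{-1}B$, the rule $p(\beta)\mapsto p(T)$ defines an isomorphism from $R_0$ to the stabilizer $G_v$ as group schemes over $k^s$, that is, isomorphisms $R_0(E)\cong G_v(E)$ natural in the commutative $k^s$-algebra $E$. It induces isomorphisms from $R_0(E)/\mu_2(E)$ to the stabilizer of $v$ in $\mathrm{SL}_n(E)/\mu_2(E)$ for all $E$, and hence, passing to associated sheaves, an isomorphism from $R_0/\mu_2$ to the stabilizer $H_v$. These isomorphisms are compatible with descent: for $E=k^s$ they define $\mathrm{Gal}(k^s/k)$-equivariant isomorphisms $R_0(k^s)\cong G_f$ and $(R_0/\mu_2)(k^s)\cong H_f$. 2. The sequence $1\to R_0\to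 R\xrightarrow{N}\mu_2\to 1$ is exact on $k^s$-points. Let $\delta_0:H^1(k,\mu_2)\to H^2(k,R_0)\cong H^2(k,G_f)$ be its connecting homomorphism. The classes $d_f^G$ and $d_f^H$ exist and are independent of the choices of $v$ and $g_\sigma$, and $d_f^G=\delta_0(f_0)$, where $f_0$ is viewed in $k^\times/k^{\times2}=H^1(k,\mu_2)$. 3. The natural map $H^2(k,G_f)\to H^2(k,H_f)$ induced by $G\to H$ sends $d_f^G$ to $d_f^H$. -/

import Mathlib

open scoped TensorProduct

universe u v

namespace PairsOfForms

/-!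
### Continuous cohomology of discrete modules in degrees one and two

`Γ` is a topological group acting on an abelian group `M` (written multiplicatively and regarded as
discrete), so that continuous cochains are the locally constant ones.
-/

section Cohomology

variable (Γ : Type*) [Group Γ] [TopologicalSpace Γ]

/-- Continuous `1`-cocycles: locally constant `c` with `c (σ τ) = σ (c τ) * c σ`. -/
def Z1 (M : Type*) [CommGroup M] [MulDistribMulAction Γ M] : Subgroup (Γ → M) where
  carrier := {c | IsLocallyConstant c ∧ groupCohomology.IsMulCocycle₁ c}
  one_mem' := ⟨IsLocallyConstant.one, fun g h => by simp⟩
  mul_mem' := by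
    rintro a b ⟨ha, ha'⟩ ⟨hb, hb'⟩
    refine ⟨ha.mul hb, fun g h => ?_⟩
    simp only [Pi.mul_apply, ha' g h, hb' g h, smul_mul']
    exact mul_mul_mul_comm _ _ _ _
  inv_mem' := by
    rintro a ⟨ha, ha'⟩
    refine ⟨ha.inv, fun g h => ?_⟩
    simp only [Pi.inv_apply, ha' g h, smul_inv', mul_inv]

/-- `1`-coboundaries `σ ↦ σ m / m`. -/
def B1 (M : Type*) [CommGroup M] [MulDistribMulAction Γ M] : Subgroup (Z1 Γ M) where
  carrier := {c | groupCohomology.IsMulCoboundary₁ c.1}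
  one_mem' := ⟨1, fun g => by simp⟩
  mul_mem' := by
    rintro a b ⟨x, hx⟩ ⟨y, hy⟩
    refine ⟨x * y, fun g => ?_⟩
    simp only [Subgroup.coe_mul, Pi.mul_apply, ← hx, ← hy, smul_mul']
    exact mul_div_mul_comm _ _ _ _
  inv_mem' := by
    rintro a ⟨x, hx⟩
    refine ⟨x⁻¹, fun g => ?_⟩
    simp only [Subgroup.coe_inv, Pi.inv_apply, ← hx, smul_inv', inv_div]
    simp [div_eq_mul_inv, mul_comm]

/-- The continuous cohomology group `H¹(Γ, M)`. -/
abbrev H1 (M : Type*) [CommGroup M] [MulDistribMulAction Γ M] : Type _ := Z1 Γ M ⧸ B1 Γ M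

/-- Continuous `2`-cocycles: locally constant `c` with
`c (σ τ, ρ) * c (σ, τ) = σ (c (τ, ρ)) * c (σ, τ ρ)`. -/
def Z2 (M : Type*) [CommGroup M] [MulDistribMulAction Γ M] : Subgroup (Γ × Γ → M) where
  carrier := {c | IsLocallyConstant c ∧ groupCohomology.IsMulCocycle₂ c}
  one_mem' := ⟨IsLocallyConstant.one, fun g h j => by simp⟩
  mul_mem' := by
    rintro a b ⟨ha, ha'⟩ ⟨hb, hb'⟩
    refine ⟨ha.mul hb, fun g h j => ?_⟩
    simp only [Pi.mul_apply, smul_mul']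
    rw [mul_mul_mul_comm, ha' g h j, hb' g h j]
    exact mul_mul_mul_comm _ _ _ _
  inv_mem' := by
    rintro a ⟨ha, ha'⟩
    refine ⟨ha.inv, fun g h j => ?_⟩
    simp only [Pi.inv_apply, smul_inv']
    rw [← mul_inv, ha' g h j, mul_inv]

/-- `2`-coboundaries `(σ, τ) ↦ σ (x τ) / x (σ τ) * x σ` of continuous `1`-cochains `x`. -/
def B2 (M : Type*) [CommGroup M] [MulDistribMulAction Γ M] : Subgroup (Z2 Γ M) where
  carrier := {c | ∃ x : Γ → M, IsLocallyConstant x ∧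
    ∀ σ τ : Γ, σ • x τ / x (σ * τ) * x σ = c.1 (σ, τ)}
  one_mem' := ⟨1, IsLocallyConstant.one, fun σ τ => by simp⟩
  mul_mem' := by
    rintro a b ⟨x, hx, hx'⟩ ⟨y, hy, hy'⟩
    refine ⟨x * y, hx.mul hy, fun σ τ => ?_⟩
    simp only [Subgroup.coe_mul, Pi.mul_apply, ← hx', ← hy', smul_mul']
    rw [mul_div_mul_comm, mul_mul_mul_comm]
  inv_mem' := by
    rintro a ⟨x, hx, hx'⟩
    refine ⟨x⁻¹, hx.inv, fun σ τ => ?_⟩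
    simp only [Subgroup.coe_inv, Pi.inv_apply, ← hx', smul_inv', mul_inv, inv_div]
    simp [div_eq_mul_inv, mul_comm]

/-- The continuous cohomology group `H²(Γ, M)`. -/
abbrev H2 (M : Type*) [CommGroup M] [MulDistribMulAction Γ M] : Type _ := Z2 Γ M ⧸ B2 Γ M

variable {Γ}
variable {M M' : Type*} [CommGroup M] [MulDistribMulAction Γ M] [CommGroup M']
  [MulDistribMulAction Γ M']

/-- Composition of `2`-cocycles with a `Γ`-equivariant homomorphism. -/
def Z2.map (φ : M →* M') (hφ : ∀ (σ : Γ) (m : M), φ (σ • m) = σ • φ m) : Z2 Γ M →* Z2 Γ M' where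
  toFun c := ⟨fun p => φ (c.1 p), c.2.1.comp φ, fun g h j => by
    simp only [← hφ, ← map_mul, c.2.2 g h j]⟩
  map_one' := by ext p; simp
  map_mul' a b := by ext p; simp

/-- The map `H²(Γ, M) → H²(Γ, M')` induced by a `Γ`-equivariant homomorphism `M → M'`. -/
def H2.map (φ : M →* M') (hφ : ∀ (σ : Γ) (m : M), φ (σ • m) = σ • φ m) : H2 Γ M →* H2 Γ M' :=
  QuotientGroup.map _ _ (Z2.map φ hφ) (by
    rintro c ⟨x, hx, hx'⟩
    refine ⟨fun σ => φ (x σ), hx.comp φ, fun σ τ => ?_⟩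
    simp only [← hφ, ← map_mul, ← map_div, hx' σ τ]
    rfl)

/-- `1 → A → B → C → 1` (with maps `i` and `π`) is a short exact sequence of discrete
`Γ`-modules. -/
structure IsShortExact (Γ : Type*) [Group Γ] [TopologicalSpace Γ] {A B C : Type*} [CommGroup A]
    [MulDistribMulAction Γ A] [CommGroup B] [MulDistribMulAction Γ B] [CommGroup C]
    [MulDistribMulAction Γ C] (i : A →* B) (π : B →* C) : Prop where
  map_smul_left : ∀ (σ : Γ) (a : A), i (σ • a) = σ • i a
  map_smul_right : ∀ (σ : Γ) (b : B), π (σ • b) = σ • π b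
  injective : Function.Injective i
  exact : ∀ b : B, π b = 1 ↔ ∃ a : A, i a = b
  surjective : Function.Surjective π
  discrete : ∀ b : B, IsLocallyConstant fun σ : Γ => σ • b

end Cohomology

section Connecting

variable {Γ : Type*} [Group Γ] [TopologicalSpace Γ]
  {A B C : Type*} [CommGroup A] [MulDistribMulAction Γ A] [CommGroup B] [MulDistribMulAction Γ B]
  [CommGroup C] [MulDistribMulAction Γ C] {i : A →* B} {π : B →* C}

lemma IsShortExact.exists_cocycle [IsTopologicalGroup Γ] (h : IsShortExact Γ i π) (c : Z1 Γ C) (b : Γ → B)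
    (hb : IsLocallyConstant b) (hbc : ∀ σ, π (b σ) = c.1 σ) :
    ∃ a : Z2 Γ A, ∀ σ τ : Γ, i (a.1 (σ, τ)) = σ • b τ / b (σ * τ) * b σ := by
  have key : ∀ p : Γ × Γ, ∃ a : A, i a = p.1 • b p.2 / b (p.1 * p.2) * b p.1 := by
    rintro ⟨σ, τ⟩
    rw [← h.exact]
    have := c.2.2 σ τ
    simp only [map_mul, map_div, h.map_smul_right, hbc, this]
    simp
  choose a ha using key
  refine ⟨⟨a, ?_, ?_⟩, fun σ τ => ha (σ, τ)⟩
  · rw [IsLocallyConstant.iff_eventually_eq]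
    rintro ⟨σ, τ⟩
    have h1 := (IsLocallyConstant.iff_eventually_eq _).1 hb σ
    have h2 := (IsLocallyConstant.iff_eventually_eq _).1 hb τ
    have h3 := (IsLocallyConstant.iff_eventually_eq _).1
      (hb.comp_continuous (continuous_mul (M := Γ))) (σ, τ)
    have h4 := (IsLocallyConstant.iff_eventually_eq _).1 (h.discrete (b τ)) σ
    have h1' := (continuous_fst.tendsto (σ, τ)).eventually h1
    have h2' := (continuous_snd.tendsto (σ, τ)).eventually h2
    have h4' := (continuous_fst.tendsto (σ, τ)).eventually h4
    filter_upwards [h1', h2', h3, h4'] with p e1 e2 e3 e4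
    apply h.injective
    rw [ha, ha]
    simp only [Function.comp_apply] at e3
    simp only [e1, e2, e3, e4]
  · intro σ τ ρ
    apply h.injective
    simp only [map_mul, h.map_smul_left, ha, smul_mul', smul_div', mul_smul, mul_assoc σ τ ρ]
    simp only [div_eq_mul_inv]
    generalize b (σ * (τ * ρ)) = x1
    generalize σ • τ • b ρ = x2
    generalize b (σ * τ) = x3
    generalize σ • b τ = x4
    generalize σ • b (τ * ρ) = x5
    generalize b σ = x6
    have key : ∀ x1 x2 x3 x4 x5 x6 : Additive B,
        x2 + -x1 + x3 + (x4 + -x3 + x6) = x2 + -x5 + x4 + (x5 + -x1 + x6) := by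
      intros; abel
    exact key x1 x2 x3 x4 x5 x6

lemma IsShortExact.mem_B2 (h : IsShortExact Γ i π) (c : Z1 Γ C) (hc : c ∈ B1 Γ C) (b : Γ → B)
    (hb : IsLocallyConstant b) (hbc : ∀ σ, π (b σ) = c.1 σ) (a : Z2 Γ A)
    (ha : ∀ σ τ : Γ, i (a.1 (σ, τ)) = σ • b τ / b (σ * τ) * b σ) : a ∈ B2 Γ A := by
  obtain ⟨m, hm⟩ := hc
  obtain ⟨m', rfl⟩ := h.surjective m
  have key : ∀ σ : Γ, ∃ e : A, i e = b σ / (σ • m' / m') := fun σ => by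
    rw [← h.exact, map_div, hbc, ← hm, map_div, h.map_smul_right, div_self']
  choose e he using key
  refine ⟨e, ?_, fun σ τ => h.injective ?_⟩
  · rw [IsLocallyConstant.iff_eventually_eq]
    intro σ
    filter_upwards [(IsLocallyConstant.iff_eventually_eq _).1 hb σ,
      (IsLocallyConstant.iff_eventually_eq _).1 (h.discrete m') σ] with p e1 e2
    apply h.injective
    simp only [he, e1, e2]
  · simp only [ha, map_mul, map_div, h.map_smul_left, he, smul_div', mul_smul]
    generalize b σ = x1
    generalize b (σ * τ) = x2
    generalize σ • b τ = x3
    generalize σ • τ • m' = x4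
    generalize σ • m' = x5
    have key : ∀ x1 x2 x3 x4 x5 x6 : Additive B,
        x3 - (x4 - x5) - (x2 - (x4 - x6)) + (x1 - (x5 - x6)) = x3 - x2 + x1 := by
      intros; abel
    exact key x1 x2 x3 x4 x5 m'

/-- The value of the connecting map on a `1`-cocycle `c`: lift `c` to a locally constant `b`
and take the class of the `2`-cocycle `(σ, τ) ↦ σ (b τ) / b (σ τ) * b σ`. -/
noncomputable def connectingAux [IsTopologicalGroup Γ] (h : IsShortExact Γ i π) (c : Z1 Γ C) : Z2 Γ A :=
  (h.exists_cocycle c (Function.surjInv h.surjective ∘ c.1) (c.2.1.comp _)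
    fun _ => Function.surjInv_eq h.surjective _).choose

lemma connectingAux_spec [IsTopologicalGroup Γ] (h : IsShortExact Γ i π) (c : Z1 Γ C) (σ τ : Γ) :
    i ((connectingAux h c).1 (σ, τ)) =
      σ • Function.surjInv h.surjective (c.1 τ) / Function.surjInv h.surjective (c.1 (σ * τ)) *
        Function.surjInv h.surjective (c.1 σ) :=
  (h.exists_cocycle c (Function.surjInv h.surjective ∘ c.1) (c.2.1.comp _)
    fun _ => Function.surjInv_eq h.surjective _).choose_spec σ τ

/-- The connecting homomorphism `H¹(Γ, C) → H²(Γ, A)` of a short exact sequence of discrete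
`Γ`-modules `1 → A → B → C → 1`. -/
noncomputable def connecting [IsTopologicalGroup Γ] (h : IsShortExact Γ i π) : H1 Γ C →* H2 Γ A :=
  QuotientGroup.lift (B1 Γ C)
    (MonoidHom.mk' (fun c => (QuotientGroup.mk (connectingAux h c) : H2 Γ A)) (by
      intro c c'
      rw [← QuotientGroup.mk_mul, QuotientGroup.eq]
      refine h.mem_B2 1 (one_mem _)
        (fun σ => (Function.surjInv h.surjective ((c * c').1 σ))⁻¹ *
          (Function.surjInv h.surjective (c.1 σ) * Function.surjInv h.surjective (c'.1 σ)))
        (((c * c').2.1.comp fun x => (Function.surjInv h.surjective x)⁻¹).mul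
          ((c.2.1.comp (Function.surjInv h.surjective)).mul
            (c'.2.1.comp (Function.surjInv h.surjective)))) ?_ _ ?_
      · intro σ
        simp only [map_mul, map_inv, Function.surjInv_eq h.surjective, Subgroup.coe_mul,
          Pi.mul_apply]
        simp
      · intro σ τ
        simp only [Subgroup.coe_mul, Subgroup.coe_inv, Pi.mul_apply, Pi.inv_apply, map_mul,
          map_inv, connectingAux_spec, smul_mul', smul_inv']
        generalize Function.surjInv h.surjective (c.1 σ) = x1
        generalize Function.surjInv h.surjective (c'.1 σ) = x2
        generalize Function.surjInv h.surjective (c.1 (σ * τ)) = x3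
        generalize Function.surjInv h.surjective (c'.1 (σ * τ)) = x4
        generalize σ • Function.surjInv h.surjective (c.1 τ) = x5
        generalize σ • Function.surjInv h.surjective (c'.1 τ) = x6
        generalize Function.surjInv h.surjective (c.1 σ * c'.1 σ) = x7
        generalize Function.surjInv h.surjective (c.1 (σ * τ) * c'.1 (σ * τ)) = x8
        generalize σ • Function.surjInv h.surjective (c.1 τ * c'.1 τ) = x9
        have key : ∀ x1 x2 x3 x4 x5 x6 x7 x8 x9 : Additive B,
            -(x9 - x8 + x7) + ((x5 - x3 + x1) + (x6 - x4 + x2)) =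
              (-x9 + (x5 + x6)) - (-x8 + (x3 + x4)) + (-x7 + (x1 + x2)) := by
          intros; abel
        exact key x1 x2 x3 x4 x5 x6 x7 x8 x9))
    (fun c hc => (QuotientGroup.eq_one_iff _).2
      (h.mem_B2 c hc (Function.surjInv h.surjective ∘ c.1) (c.2.1.comp _)
        (fun _ => Function.surjInv_eq h.surjective _) _ (connectingAux_spec h c)))

end Connecting

/-!
### Descended stabilizers and the obstruction class

`Γ` acts on the group `G` and on the set `X`, and `G` acts on `X` compatibly:
`σ (g x) = (σ g) (σ x)`.
-/

section Obstruction

/-- The group of families `(b_x)`, `x ∈ X`, with `b_x` in the stabilizer of `x` and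
`b_{g x} = g b_x g⁻¹`. If `G` acts transitively on `X` with abelian stabilizers, then evaluation at
`x` is an isomorphism onto the stabilizer of `x`, and this group, with the action of `Γ` below, is
the group obtained from the stabilizers by descent; the inverse of evaluation at `x` is then the
canonical isomorphism from the stabilizer of `x`. -/
def DescStab (G X : Type*) [Group G] [MulAction G X] : Subgroup (X → G) where
  carrier := {b | (∀ x, b x • x = x) ∧ ∀ (g : G) (x : X), b (g • x) = g * b x * g⁻¹}
  one_mem' := ⟨fun x => one_smul _ _, fun g x => by simp⟩
  mul_mem' := by
    rintro a b ⟨ha, ha'⟩ ⟨hb, hb'⟩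
    refine ⟨fun x => ?_, fun g x => ?_⟩
    · rw [Pi.mul_apply, mul_smul, hb, ha]
    · simp only [Pi.mul_apply, ha', hb']
      group
  inv_mem' := by
    rintro a ⟨ha, ha'⟩
    refine ⟨fun x => ?_, fun g x => ?_⟩
    · rw [Pi.inv_apply, inv_smul_eq_iff, ha]
    · simp only [Pi.inv_apply, ha']
      group

/-- Such families automatically commute. -/
instance (G X : Type*) [Group G] [MulAction G X] : CommGroup (DescStab G X) where
  mul_comm a b := by
    ext x
    have h := a.2.2 (b.1 x) x
    rw [b.2.1 x] at h
    have h' : a.1 x * b.1 x = b.1 x * a.1 x := by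
      conv_lhs => rw [h]
      group
    exact h'

variable {Γ : Type*} [Group Γ] {G X : Type*} [Group G] [MulAction G X] [MulDistribMulAction Γ G]
  [MulAction Γ X] [SMulDistribClass Γ G X]

/-- The Galois action on the descended stabilizer: `(σ b)_{σ x} = σ (b_x)`. -/
instance : MulDistribMulAction Γ (DescStab G X) where
  smul σ b := ⟨fun x => σ • b.1 (σ⁻¹ • x), fun x => by
    have := congrArg (fun y => σ • y) (b.2.1 (σ⁻¹ • x))
    simpa only [smul_distrib_smul, smul_inv_smul] using this, fun g x => by
    simp only [smul_distrib_smul, b.2.2, smul_mul', smul_inv', smul_inv_smul]⟩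
  one_smul b := by
    ext x
    change (1 : Γ) • b.1 ((1 : Γ)⁻¹ • x) = b.1 x
    simp
  mul_smul σ τ b := by
    ext x
    change (σ * τ) • b.1 ((σ * τ)⁻¹ • x) = σ • τ • b.1 (τ⁻¹ • σ⁻¹ • x)
    simp only [mul_inv_rev, mul_smul]
  smul_one σ := by
    ext x
    change σ • (1 : G) = 1
    simp
  smul_mul σ a b := by
    ext x
    change σ • (a.1 (σ⁻¹ • x) * b.1 (σ⁻¹ • x)) = σ • a.1 (σ⁻¹ • x) * σ • b.1 (σ⁻¹ • x)
    simp

/-- `d ∈ H²(Γ, DescStab G X)` is an obstruction class for the action of `G` on `X`: for some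
`x ∈ X` and some continuous choice of `g_σ ∈ G` with `g_σ (σ x) = x`, it is the class of the
`2`-cocycle `d_{σ,τ}` whose value at `x` is `g_σ · σ(g_τ) · g_{στ}⁻¹`. -/
def IsObstructionClass [TopologicalSpace Γ] (d : H2 Γ (DescStab G X)) : Prop :=
  ∃ (x : X) (g : Γ → G) (c : Z2 Γ (DescStab G X)), IsLocallyConstant g ∧
    (∀ σ, g σ • σ • x = x) ∧
    (∀ σ τ, (c.1 (σ, τ)).1 x = g σ * σ • g τ * (g (σ * τ))⁻¹) ∧
    d = QuotientGroup.mk c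

variable {H : Type*} [Group H] [MulAction H X] [MulDistribMulAction Γ H] [SMulDistribClass Γ H X]

/-- The natural map of descended stabilizers induced by a surjection `p : G → H` of groups acting
compatibly on `X`. -/
def DescStab.map (p : G →* H) (hp : Function.Surjective p) (hX : ∀ (g : G) (x : X), p g • x = g • x) :
    DescStab G X →* DescStab H X where
  toFun b := ⟨fun x => p (b.1 x), fun x => by rw [hX, b.2.1], fun h x => by
    obtain ⟨g, rfl⟩ := hp h
    change p (b.1 (p g • x)) = p g * p (b.1 x) * (p g)⁻¹
    rw [hX, b.2.2, map_mul, map_mul, map_inv]⟩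
  map_one' := by
    ext x
    exact map_one p
  map_mul' a b := by
    ext x
    exact map_mul p _ _

lemma DescStab.map_smul (p : G →* H) (hp : Function.Surjective p)
    (hX : ∀ (g : G) (x : X), p g • x = g • x) (hΓ : ∀ (σ : Γ) (g : G), p (σ • g) = σ • p g)
    (σ : Γ) (b : DescStab G X) :
    DescStab.map p hp hX (σ • b) = σ • DescStab.map p hp hX b := by
  ext x
  exact hΓ _ _

end Obstruction

/-!
### Finite group schemes, as functors of points on commutative `k`-algebras
-/

section Schemes

/-- The map on `E`-points of `Res_{L/k} 𝔾_a` induced by `ψ : E → E'`. -/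
noncomputable abbrev baseMap (k : Type*) [Field k] (L : Type*) [CommRing L] [Algebra k L]
    {E E' : Type*} [CommRing E] [Algebra k E] [CommRing E'] [Algebra k E'] (ψ : E →ₐ[k] E') :
    E ⊗[k] L →ₐ[k] E' ⊗[k] L :=
  Algebra.TensorProduct.map ψ (AlgHom.id k L)

lemma norm_baseMap {k : Type*} [Field k] {L : Type*} [CommRing L] [Algebra k L] [Module.Finite k L]
    {E E' : Type*} [CommRing E] [Algebra k E] [CommRing E'] [Algebra k E'] (ψ : E →ₐ[k] E')
    (x : E ⊗[k] L) : Algebra.norm E' (baseMap k L ψ x) = ψ (Algebra.norm E x) := by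
  classical
  let b := Module.finBasis k L
  rw [Algebra.norm_eq_matrix_det (Algebra.TensorProduct.basis E b),
    Algebra.norm_eq_matrix_det (Algebra.TensorProduct.basis E' b), AlgHom.map_det]
  congr 1
  have hr : ∀ (y : E ⊗[k] L) i, (Algebra.TensorProduct.basis E' b).repr (baseMap k L ψ y) i =
      ψ ((Algebra.TensorProduct.basis E b).repr y i) := by
    intro y i
    induction y using TensorProduct.induction_on with
    | zero => simp
    | tmul e l => simp
    | add y z hy hz => simp only [map_add, Finsupp.add_apply, hy, hz]
  ext i j
  simp only [Algebra.leftMulMatrix_eq_repr_mul, AlgHom.mapMatrix_apply, Matrix.map_apply]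
  rw [← hr, map_mul (baseMap k L ψ)]
  simp

variable (k : Type*) [Field k] (L : Type*) [CommRing L] [Algebra k L]

/-- `E`-points of `Res_{L/k} μ₂`. -/
abbrev ResMu2 (E : Type*) [CommRing E] [Algebra k E] : Type _ := rootsOfUnity 2 (E ⊗[k] L)

/-- The norm `N : Res_{L/k} μ₂ → μ₂` on `E`-points. -/
noncomputable def normMu2 (E : Type*) [CommRing E] [Algebra k E] :
    ResMu2 k L E →* rootsOfUnity 2 E :=
  restrictRootsOfUnity (Algebra.norm E : E ⊗[k] L →* E) 2

/-- `E`-points of `(Res_{L/k} μ₂)_{N = 1}`. -/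
noncomputable abbrev R0 (E : Type*) [CommRing E] [Algebra k E] : Subgroup (ResMu2 k L E) :=
  (normMu2 k L E).ker

/-- The diagonal `μ₂(E)` inside `(Res_{L/k} μ₂)_{N = 1}(E)`. -/
def diagMu2 (E : Type*) [CommRing E] [Algebra k E] : Subgroup (R0 k L E) where
  carrier := {x | ∃ c : E, c ^ 2 = 1 ∧ ((x.1.1 : (E ⊗[k] L)ˣ) : E ⊗[k] L) = c ⊗ₜ 1}
  one_mem' := ⟨1, one_pow 2, rfl⟩
  mul_mem' := by
    rintro x y ⟨c, hc, hx⟩ ⟨d, hd, hy⟩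
    refine ⟨c * d, by rw [mul_pow, hc, hd, one_mul], ?_⟩
    simp [hx, hy]
  inv_mem' := by
    rintro x ⟨c, hc, hx⟩
    refine ⟨c, hc, ?_⟩
    simp only [Subgroup.coe_inv]
    rw [← hx, ← Units.ext_iff, inv_eq_iff_mul_eq_one, ← sq]
    exact x.1.2

/-- `(Res_{L/k} μ₂)_{N = 1}(E) / μ₂(E)`. The quotient group scheme `(Res_{L/k} μ₂)_{N = 1} / μ₂` is
the sheaf associated with this functor of `E`; if `E` is a separably closed field of
characteristic different from two, this is its group of `E`-points. -/
abbrev R0modMu2 (E : Type*) [CommRing E] [Algebra k E] : Type _ := R0 k L E ⧸ diagMu2 k L E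

variable {k L}

/-- Functoriality of `Res_{L/k} μ₂`. -/
noncomputable def ResMu2.map {E E' : Type*} [CommRing E] [Algebra k E] [CommRing E'] [Algebra k E']
    (ψ : E →ₐ[k] E') : ResMu2 k L E →* ResMu2 k L E' :=
  restrictRootsOfUnity (baseMap k L ψ) 2

lemma normMu2_map [Module.Finite k L] {E E' : Type*} [CommRing E] [Algebra k E] [CommRing E']
    [Algebra k E'] (ψ : E →ₐ[k] E') (x : ResMu2 k L E) :
    normMu2 k L E' (ResMu2.map ψ x) = restrictRootsOfUnity ψ 2 (normMu2 k L E x) := by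
  ext
  exact norm_baseMap ψ _

/-- Functoriality of `(Res_{L/k} μ₂)_{N = 1}`. -/
noncomputable def R0.map [Module.Finite k L] {E E' : Type*} [CommRing E] [Algebra k E] [CommRing E']
    [Algebra k E'] (ψ : E →ₐ[k] E') : R0 k L E →* R0 k L E' :=
  ((ResMu2.map ψ).comp (R0 k L E).subtype).codRestrict (R0 k L E') fun x => by
    rw [MonoidHom.mem_ker]
    change normMu2 k L E' (ResMu2.map ψ x.1) = 1
    rw [normMu2_map, show normMu2 k L E x.1 = 1 from x.2, map_one]

/-- Functoriality of `(Res_{L/k} μ₂)_{N = 1} / μ₂`. -/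
noncomputable def R0modMu2.map [Module.Finite k L] {E E' : Type*} [CommRing E] [Algebra k E]
    [CommRing E'] [Algebra k E'] (ψ : E →ₐ[k] E') : R0modMu2 k L E →* R0modMu2 k L E' :=
  QuotientGroup.map _ _ (R0.map ψ) (by
    rintro x ⟨c, hc, hx⟩
    refine ⟨ψ c, by rw [← map_pow, hc, map_one], ?_⟩
    change baseMap k L ψ ((x.1.1 : (E ⊗[k] L)ˣ) : E ⊗[k] L) = _
    rw [hx]
    simp)

/-! Galois actions on the points with values in an extension `K` of `k`. -/

variable {K : Type*} [Field K] [Algebra k K]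

noncomputable instance : MulDistribMulAction Gal(K/k) (rootsOfUnity 2 K) where
  smul σ x := restrictRootsOfUnity σ 2 x
  one_smul x := by ext; rfl
  mul_smul σ τ x := by ext; rfl
  smul_one _ := map_one _
  smul_mul _ x y := map_mul _ x y

noncomputable instance : MulDistribMulAction Gal(K/k) (ResMu2 k L K) where
  smul σ x := ResMu2.map (σ : K →ₐ[k] K) x
  one_smul x := by
    ext
    change baseMap k L (AlgHom.id k K) _ = _
    simp [baseMap]
  mul_smul σ τ x := by
    ext
    change baseMap k L ((σ : K →ₐ[k] K).comp (τ : K →ₐ[k] K)) _ =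
      baseMap k L (σ : K →ₐ[k] K) (baseMap k L (τ : K →ₐ[k] K) _)
    rw [← AlgHom.comp_apply, ← Algebra.TensorProduct.map_comp]
    rfl
  smul_one _ := map_one _
  smul_mul _ x y := map_mul _ x y

noncomputable instance [Module.Finite k L] : MulDistribMulAction Gal(K/k) (R0 k L K) where
  smul σ x := R0.map (σ : K →ₐ[k] K) x
  one_smul x := Subtype.ext (one_smul Gal(K/k) x.1)
  mul_smul σ τ x := Subtype.ext (mul_smul σ τ x.1)
  smul_one _ := map_one _
  smul_mul _ x y := map_mul _ x y

noncomputable instance [Module.Finite k L] : MulDistribMulAction Gal(K/k) (R0modMu2 k L K) where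
  smul σ x := R0modMu2.map (σ : K →ₐ[k] K) x
  one_smul x := by
    obtain ⟨x, rfl⟩ := QuotientGroup.mk_surjective x
    exact congrArg QuotientGroup.mk (one_smul Gal(K/k) x)
  mul_smul σ τ x := by
    obtain ⟨x, rfl⟩ := QuotientGroup.mk_surjective x
    exact congrArg QuotientGroup.mk (mul_smul σ τ x)
  smul_one _ := map_one _
  smul_mul _ x y := map_mul _ x y

/-! The Kummer class of an element of `kˣ` in `H¹(k, μ₂)`. -/

lemma isLocallyConstant_galois_smul [Algebra.IsIntegral k K] (s : K) :
    IsLocallyConstant fun σ : Gal(K/k) => σ s := by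
  rw [IsLocallyConstant.iff_eventually_eq]
  intro σ
  have h := (stabilizer_isOpen_of_isIntegral (K := k) s).mem_nhds (one_mem _)
  have hc : Filter.Tendsto (fun τ : Gal(K/k) => σ⁻¹ * τ) (nhds σ) (nhds 1) := by
    have := (continuous_const_mul σ⁻¹).tendsto σ
    rwa [inv_mul_cancel] at this
  filter_upwards [hc h] with τ hτ
  have hτ' : (σ⁻¹ * τ) • s = s := hτ
  rw [mul_smul, inv_smul_eq_iff] at hτ'
  exact hτ'

variable (K) in
lemma exists_sqrt [IsSepClosure k K] (h2 : (2 : k) ≠ 0) (u : kˣ) :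
    ∃ s : Kˣ, s ^ 2 = Units.map (algebraMap k K : k →* K) u := by
  have := IsSepClosure.sep_closed (K := K) k
  have : NeZero ((2 : ℕ) : K) := ⟨by
    rw [Nat.cast_ofNat, ← map_ofNat (algebraMap k K) 2]
    exact (map_ne_zero (algebraMap k K)).2 h2⟩
  obtain ⟨z, hz⟩ := IsSepClosed.exists_pow_nat_eq (algebraMap k K u) 2
  have hz0 : z ≠ 0 := by
    rintro rfl
    rw [zero_pow two_ne_zero] at hz
    exact (map_ne_zero (algebraMap k K)).2 u.ne_zero hz.symm
  exact ⟨Units.mk0 z hz0, Units.ext hz⟩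

/-- For `s` in `K` with `s² = u` in `k`, the cocycle `σ ↦ σ(s) / s` with values in `μ₂(K)`. -/
def kummerCocycle [Algebra.IsIntegral k K] (u : kˣ) (s : Kˣ)
    (hs : s ^ 2 = Units.map (algebraMap k K : k →* K) u) : Z1 Gal(K/k) (rootsOfUnity 2 K) where
  val σ := ⟨Units.map (σ : K →* K) s / s, by
    rw [mem_rootsOfUnity, div_pow, ← map_pow, hs, div_eq_one]
    ext
    simp⟩
  property := by
    refine ⟨?_, fun σ τ => ?_⟩
    · rw [IsLocallyConstant.iff_eventually_eq]
      intro σ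
      filter_upwards [(IsLocallyConstant.iff_eventually_eq _).1
        (isLocallyConstant_galois_smul (k := k) (s : K)) σ] with τ hτ
      ext
      simp [hτ]
    · ext
      change σ (τ s) * ((s⁻¹ : Kˣ) : K) =
        σ (τ s * ((s⁻¹ : Kˣ) : K)) * (σ s * ((s⁻¹ : Kˣ) : K))
      simp only [map_mul, Units.val_inv_eq_inv_val, map_inv₀]
      have : σ (s : K) ≠ 0 := by simp
      field_simp

variable (K) in
/-- The class in `H¹(k, μ₂)` attached to `u ∈ kˣ` by Kummer theory. -/
noncomputable def kummerClass [IsSepClosure k K] (h2 : (2 : k) ≠ 0) (u : kˣ) :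
    H1 Gal(K/k) (rootsOfUnity 2 K) :=
  haveI : Algebra.IsSeparable k K := IsSepClosure.separable
  QuotientGroup.mk (kummerCocycle u (exists_sqrt K h2 u).choose (exists_sqrt K h2 u).choose_spec)

end Schemes

/-!
### Pairs of symmetric bilinear forms
-/

section Forms

variable {n : ℕ}

/-- A pair of symmetric bilinear forms on `Eⁿ`, given by their Gram matrices. -/
@[ext]
structure SymPair (n : ℕ) (E : Type*) where
  A : Matrix (Fin n) (Fin n) E
  B : Matrix (Fin n) (Fin n) E
  symmA : A.IsSymm
  symmB : B.IsSymm

/-- Extension of scalars of a pair of forms. -/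
def SymPair.map {E E' : Type*} (ψ : E → E') (v : SymPair n E) : SymPair n E' where
  A := v.A.map ψ
  B := v.B.map ψ
  symmA := v.symmA.map ψ
  symmB := v.symmB.map ψ

abbrev SL (n : ℕ) (E : Type*) [CommRing E] : Type _ := Matrix.SpecialLinearGroup (Fin n) E

/-- The left action of `SL_n(E)` on pairs of forms: `(g • A)(w, w') = A(g⁻¹ w, g⁻¹ w')`. -/
instance (E : Type*) [CommRing E] : MulAction (SL n E) (SymPair n E) where
  smul g v :=
    { A := ((g⁻¹ : SL n E) : Matrix (Fin n) (Fin n) E).transpose * v.A *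
        ((g⁻¹ : SL n E) : Matrix (Fin n) (Fin n) E)
      B := ((g⁻¹ : SL n E) : Matrix (Fin n) (Fin n) E).transpose * v.B *
        ((g⁻¹ : SL n E) : Matrix (Fin n) (Fin n) E)
      symmA := by
        simp only [Matrix.IsSymm, Matrix.transpose_mul, Matrix.transpose_transpose, v.symmA.eq,
          Matrix.mul_assoc]
      symmB := by
        simp only [Matrix.IsSymm, Matrix.transpose_mul, Matrix.transpose_transpose, v.symmB.eq,
          Matrix.mul_assoc] }
  one_smul v := by
    ext1
    · change ((1⁻¹ : SL n E) : Matrix (Fin n) (Fin n) E).transpose * v.A *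
        ((1⁻¹ : SL n E) : Matrix (Fin n) (Fin n) E) = v.A
      simp
    · change ((1⁻¹ : SL n E) : Matrix (Fin n) (Fin n) E).transpose * v.B *
        ((1⁻¹ : SL n E) : Matrix (Fin n) (Fin n) E) = v.B
      simp
  mul_smul g h v := by
    ext1
    · change (((g * h)⁻¹ : SL n E) : Matrix (Fin n) (Fin n) E).transpose * v.A *
        (((g * h)⁻¹ : SL n E) : Matrix (Fin n) (Fin n) E) =
        ((g⁻¹ : SL n E) : Matrix (Fin n) (Fin n) E).transpose *
        (((h⁻¹ : SL n E) : Matrix (Fin n) (Fin n) E).transpose * v.A *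
        ((h⁻¹ : SL n E) : Matrix (Fin n) (Fin n) E)) *
        ((g⁻¹ : SL n E) : Matrix (Fin n) (Fin n) E)
      rw [mul_inv_rev, Matrix.SpecialLinearGroup.coe_mul, Matrix.transpose_mul]
      simp only [Matrix.mul_assoc]
    · change (((g * h)⁻¹ : SL n E) : Matrix (Fin n) (Fin n) E).transpose * v.B *
        (((g * h)⁻¹ : SL n E) : Matrix (Fin n) (Fin n) E) =
        ((g⁻¹ : SL n E) : Matrix (Fin n) (Fin n) E).transpose *
        (((h⁻¹ : SL n E) : Matrix (Fin n) (Fin n) E).transpose * v.B *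
        ((h⁻¹ : SL n E) : Matrix (Fin n) (Fin n) E)) *
        ((g⁻¹ : SL n E) : Matrix (Fin n) (Fin n) E)
      rw [mul_inv_rev, Matrix.SpecialLinearGroup.coe_mul, Matrix.transpose_mul]
      simp only [Matrix.mul_assoc]

/-- The subgroup `μ₂(E)` of scalar matrices in `SL_n(E)` (all of `μ₂(E)` if `n` is even). -/
def scalarMu2 (n : ℕ) (E : Type*) [CommRing E] : Subgroup (SL n E) where
  carrier := {g | ∃ c : E, c ^ 2 = 1 ∧ (g : Matrix (Fin n) (Fin n) E) = c • 1}
  one_mem' := ⟨1, one_pow 2, by simp⟩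
  mul_mem' := by
    rintro g h ⟨c, hc, hg⟩ ⟨d, hd, hh⟩
    refine ⟨c * d, by rw [mul_pow, hc, hd, one_mul], ?_⟩
    rw [Matrix.SpecialLinearGroup.coe_mul, hg, hh]
    simp [smul_smul, mul_comm]
  inv_mem' := by
    rintro g ⟨c, hc, hg⟩
    refine ⟨c, hc, ?_⟩
    have : g⁻¹ = g := by
      rw [inv_eq_iff_mul_eq_one]
      ext1
      rw [Matrix.SpecialLinearGroup.coe_mul, hg, smul_mul_smul_comm, ← sq, hc]
      simp
    rw [this, hg]

instance (E : Type*) [CommRing E] : (scalarMu2 n E).Normal where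
  conj_mem := by
    rintro g ⟨c, hc, hg⟩ h
    refine ⟨c, hc, ?_⟩
    have : h * g = g * h := by
      ext1
      rw [Matrix.SpecialLinearGroup.coe_mul, Matrix.SpecialLinearGroup.coe_mul, hg]
      simp
    rw [this, mul_inv_cancel_right, hg]

/-- `SL_n(E) / μ₂(E)`. The quotient group scheme `SL_n / μ₂` is the sheaf associated with this
functor of `E`; if `E` is a separably closed field of characteristic different from two, this is its
group of `E`-points. -/
abbrev SLmodMu2 (n : ℕ) (E : Type*) [CommRing E] : Type _ := SL n E ⧸ scalarMu2 n E

lemma smul_eq_self_of_mem_scalarMu2 {E : Type*} [CommRing E] {g : SL n E} (hg : g ∈ scalarMu2 n E)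
    (v : SymPair n E) : g • v = v := by
  obtain ⟨c, hc, hg⟩ := inv_mem hg
  ext1
  · change ((g⁻¹ : SL n E) : Matrix (Fin n) (Fin n) E).transpose * v.A *
        ((g⁻¹ : SL n E) : Matrix (Fin n) (Fin n) E) = v.A
    rw [hg]
    simp [smul_smul, ← sq, hc]
  · change ((g⁻¹ : SL n E) : Matrix (Fin n) (Fin n) E).transpose * v.B *
        ((g⁻¹ : SL n E) : Matrix (Fin n) (Fin n) E) = v.B
    rw [hg]
    simp [smul_smul, ← sq, hc]

/-- The action of `SL_n(E) / μ₂(E)` induced by that of `SL_n(E)`. -/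
instance (E : Type*) [CommRing E] : MulAction (SLmodMu2 n E) (SymPair n E) :=
  MulAction.compHom (SymPair n E)
    (QuotientGroup.lift (scalarMu2 n E) (MulAction.toPermHom (SL n E) (SymPair n E)) fun g hg => by
      ext1 v
      exact smul_eq_self_of_mem_scalarMu2 hg v)

lemma SLmodMu2.mk_smul {E : Type*} [CommRing E] (g : SL n E) (v : SymPair n E) :
    (QuotientGroup.mk g : SLmodMu2 n E) • v = g • v := rfl

/-- Functoriality of `SL_n(E) / μ₂(E)`. -/
def SLmodMu2.map {E E' : Type*} [CommRing E] [CommRing E'] (ψ : E →+* E') :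
    SLmodMu2 n E →* SLmodMu2 n E' :=
  QuotientGroup.map _ _ (Matrix.SpecialLinearGroup.map ψ) (by
    rintro g ⟨c, hc, hg⟩
    refine ⟨ψ c, by rw [← map_pow, hc, map_one], ?_⟩
    change (g : Matrix (Fin n) (Fin n) E).map ψ = _
    rw [hg]
    ext i j
    simp only [Matrix.map_apply, Matrix.smul_apply, smul_eq_mul, map_mul, Matrix.one_apply]
    split_ifs <;> simp)

lemma SymPair.map_smul {E E' : Type*} [CommRing E] [CommRing E'] (ψ : E →+* E') (g : SL n E)
    (v : SymPair n E) :
    (g • v).map ψ = Matrix.SpecialLinearGroup.map ψ g • v.map ψ := by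
  have key : ∀ M : Matrix (Fin n) (Fin n) E,
      (((g⁻¹ : SL n E) : Matrix (Fin n) (Fin n) E).transpose * M *
        ((g⁻¹ : SL n E) : Matrix (Fin n) (Fin n) E)).map ψ =
      (((Matrix.SpecialLinearGroup.map ψ g)⁻¹ : SL n E') :
        Matrix (Fin n) (Fin n) E').transpose * M.map ψ *
        (((Matrix.SpecialLinearGroup.map ψ g)⁻¹ : SL n E') : Matrix (Fin n) (Fin n) E') := by
    intro M
    rw [Matrix.map_mul, Matrix.map_mul, ← map_inv]
    rfl
  ext1
  · exact key v.A
  · exact key v.B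

/-- The binary form `f_0 x^n + f_1 x^{n-1} y + ⋯ + f_n y^n`, with `x`, `y` the variables `0`, `1`. -/
noncomputable def binaryForm {k : Type*} [CommRing k] (f : Fin (n + 1) → k) :
    MvPolynomial (Fin 2) k :=
  ∑ i : Fin (n + 1), MvPolynomial.C (f i) * MvPolynomial.X 0 ^ (n - (i : ℕ)) *
    MvPolynomial.X 1 ^ (i : ℕ)

/-- The polynomial `f(x, 1)`. -/
noncomputable def dehomogenization {k : Type*} [CommRing k] (f : Fin (n + 1) → k) : Polynomial k :=
  ∑ i : Fin (n + 1), Polynomial.C (f i) * Polynomial.X ^ (n - (i : ℕ))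

/-- The monic polynomial `g(x) = x^n + (f_1 / f_0) x^{n-1} + ⋯ + f_n / f_0`. -/
noncomputable def monicPoly {k : Type*} [Field k] (f : Fin (n + 1) → k) : Polynomial k :=
  Polynomial.X ^ n + ∑ i : Fin n, Polynomial.C (f i.succ / f 0) * Polynomial.X ^ (n - (i + 1 : ℕ))

lemma dehomogenization_eq {k : Type*} [Field k] (f : Fin (n + 1) → k) (hf : f 0 ≠ 0) :
    dehomogenization f = Polynomial.C (f 0) * monicPoly f := by
  rw [dehomogenization, monicPoly, Fin.sum_univ_succ, mul_add, Finset.mul_sum]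
  refine congrArg₂ _ (by simp) ?_
  refine Finset.sum_congr rfl fun i _ => ?_
  rw [← mul_assoc, ← Polynomial.C_mul, mul_div_cancel₀ _ hf]
  simp

lemma monicPoly_monic {k : Type*} [Field k] (f : Fin (n + 1) → k) : (monicPoly f).Monic := by
  refine Polynomial.monic_X_pow_add ((Polynomial.degree_sum_le _ _).trans_lt ?_)
  refine (Finset.sup_lt_iff (WithBot.bot_lt_coe n)).2 ?_
  intro i _
  refine (Polynomial.degree_C_mul_X_pow_le _ _).trans_lt ?_
  exact WithBot.coe_lt_coe.2 (by omega : n - (i + 1 : ℕ) < n)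

/-- The algebra `L = k[x] / (g)`. -/
abbrev AlgL {k : Type*} [Field k] (f : Fin (n + 1) → k) : Type _ := AdjoinRoot (monicPoly f)

instance {k : Type*} [Field k] (f : Fin (n + 1) → k) : Module.Finite k (AlgL f) :=
  (monicPoly_monic f).finite_adjoinRoot

/-- The value `p(β)` in `E ⊗ L` of a polynomial `p` over `E`, where `β` is the image of `x` in `L`. -/
noncomputable def evalBeta {k : Type*} [Field k] (f : Fin (n + 1) → k) {E : Type*} [CommRing E]
    [Algebra k E] (p : Polynomial E) : E ⊗[k] AlgL f :=
  Polynomial.aeval (A := E ⊗[k] AlgL f) ((1 : E) ⊗ₜ[k] AdjoinRoot.root (monicPoly f)) p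

/-- The operator `T = A⁻¹ B` attached to a pair of forms `(A, B)` with `A` nondegenerate. -/
noncomputable def SymPair.T {E : Type*} [CommRing E] (v : SymPair n E) :
    Matrix (Fin n) (Fin n) E :=
  v.A⁻¹ * v.B

/-- `V_f(E)`: pairs `(A, B)` of symmetric forms over the `k`-algebra `E` whose invariant binary form
`disc (x A - y B) = (-1)^{n(n-1)/2} det (x A - y B)` is `f`. -/
def fiber {k : Type*} [CommRing k] (f : Fin (n + 1) → k) (E : Type*) [CommRing E] [Algebra k E] :
    Set (SymPair n E) :=
  {v | (-1) ^ (n * (n - 1) / 2) *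
      Matrix.det ((MvPolynomial.X 0 : MvPolynomial (Fin 2) E) • v.A.map MvPolynomial.C -
        (MvPolynomial.X 1 : MvPolynomial (Fin 2) E) • v.B.map MvPolynomial.C) =
    MvPolynomial.map (algebraMap k E) (binaryForm f)}

lemma smul_mem_fiber {k : Type*} [CommRing k] {f : Fin (n + 1) → k} {E : Type*} [CommRing E]
    [Algebra k E] (g : SL n E) {v : SymPair n E} (hv : v ∈ fiber f E) : g • v ∈ fiber f E := by
  have hv' := hv
  rw [fiber, Set.mem_ofPred_eq] at hv' ⊢
  rw [← hv']
  congr 1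
  set M : Matrix (Fin n) (Fin n) E := ((g⁻¹ : SL n E) : Matrix (Fin n) (Fin n) E) with hM
  set M' : Matrix (Fin n) (Fin n) (MvPolynomial (Fin 2) E) := M.map MvPolynomial.C with hM'
  have hA : (g • v).A.map (MvPolynomial.C (σ := Fin 2)) =
      M'.transpose * v.A.map MvPolynomial.C * M' := by
    change (M.transpose * v.A * M).map (MvPolynomial.C (σ := Fin 2)) = _
    rw [Matrix.map_mul, Matrix.map_mul]
    rfl
  have hB : (g • v).B.map (MvPolynomial.C (σ := Fin 2)) =
      M'.transpose * v.B.map MvPolynomial.C * M' := by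
    change (M.transpose * v.B * M).map (MvPolynomial.C (σ := Fin 2)) = _
    rw [Matrix.map_mul, Matrix.map_mul]
    rfl
  have hdet : M'.det = 1 := by
    have := RingHom.map_det (MvPolynomial.C (σ := Fin 2) (R := E)) M
    rw [hM, Matrix.SpecialLinearGroup.det_coe, map_one] at this
    exact this.symm
  rw [hA, hB]
  have : (MvPolynomial.X 0 : MvPolynomial (Fin 2) E) •
        (M'.transpose * v.A.map MvPolynomial.C * M') -
      (MvPolynomial.X 1 : MvPolynomial (Fin 2) E) •
        (M'.transpose * v.B.map MvPolynomial.C * M') =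
      M'.transpose * ((MvPolynomial.X 0 : MvPolynomial (Fin 2) E) • v.A.map MvPolynomial.C -
        (MvPolynomial.X 1 : MvPolynomial (Fin 2) E) • v.B.map MvPolynomial.C) * M' := by
    rw [Matrix.mul_sub, Matrix.sub_mul, Matrix.mul_smul, Matrix.smul_mul, Matrix.mul_smul,
      Matrix.smul_mul]
  rw [this, Matrix.det_mul, Matrix.det_mul, Matrix.det_transpose, hdet, one_mul, mul_one]

lemma map_mem_fiber {k : Type*} [CommRing k] {f : Fin (n + 1) → k} {E E' : Type*} [CommRing E]
    [Algebra k E] [CommRing E'] [Algebra k E'] (ψ : E →ₐ[k] E') {v : SymPair n E}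
    (hv : v ∈ fiber f E) : v.map ψ ∈ fiber f E' := by
  have hv' := congrArg (MvPolynomial.map (σ := Fin 2) (ψ : E →+* E')) hv
  rw [fiber, Set.mem_ofPred_eq]
  rw [MvPolynomial.map_map, AlgHom.comp_algebraMap, map_mul, map_pow, map_neg, map_one,
    RingHom.map_det] at hv'
  rw [← hv']
  congr 2
  ext1 i j
  simp [SymPair.map]

instance {k : Type*} [CommRing k] (f : Fin (n + 1) → k) (E : Type*) [CommRing E] [Algebra k E] :
    MulAction (SL n E) (fiber f E) where
  smul g v := ⟨g • v.1, smul_mem_fiber g v.2⟩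
  one_smul v := Subtype.ext (one_smul (SL n E) v.1)
  mul_smul g h v := Subtype.ext (mul_smul g h v.1)

instance {k : Type*} [CommRing k] (f : Fin (n + 1) → k) (E : Type*) [CommRing E] [Algebra k E] :
    MulAction (SLmodMu2 n E) (fiber f E) where
  smul h v := ⟨h • v.1, by
    obtain ⟨g, rfl⟩ := QuotientGroup.mk_surjective h
    exact smul_mem_fiber g v.2⟩
  one_smul v := Subtype.ext (one_smul (SLmodMu2 n E) v.1)
  mul_smul g h v := Subtype.ext (mul_smul g h v.1)

/-! Galois actions on the points with values in an extension `K` of `k`. -/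

variable {k K : Type*} [Field k] [Field K] [Algebra k K]

instance : MulDistribMulAction Gal(K/k) (SL n K) where
  smul σ g := Matrix.SpecialLinearGroup.map (σ : K →+* K) g
  one_smul g := by ext; rfl
  mul_smul σ τ g := by ext; rfl
  smul_one _ := map_one _
  smul_mul _ x y := map_mul _ x y

instance : MulDistribMulAction Gal(K/k) (SLmodMu2 n K) where
  smul σ g := SLmodMu2.map (σ : K →+* K) g
  one_smul x := by
    obtain ⟨x, rfl⟩ := QuotientGroup.mk_surjective x
    exact congrArg QuotientGroup.mk (one_smul Gal(K/k) x)
  mul_smul σ τ x := by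
    obtain ⟨x, rfl⟩ := QuotientGroup.mk_surjective x
    exact congrArg QuotientGroup.mk (mul_smul σ τ x)
  smul_one _ := map_one _
  smul_mul _ x y := map_mul _ x y

instance (f : Fin (n + 1) → k) : MulAction Gal(K/k) (fiber f K) where
  smul σ v := ⟨v.1.map σ, map_mem_fiber (σ : K →ₐ[k] K) v.2⟩
  one_smul v := by
    apply Subtype.ext
    ext <;> rfl
  mul_smul σ τ v := by
    apply Subtype.ext
    ext <;> rfl

instance (f : Fin (n + 1) → k) : SMulDistribClass Gal(K/k) (SL n K) (fiber f K) where
  smul_distrib_smul σ g v := Subtype.ext (SymPair.map_smul (σ : K →+* K) g v.1)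

instance (f : Fin (n + 1) → k) : SMulDistribClass Gal(K/k) (SLmodMu2 n K) (fiber f K) where
  smul_distrib_smul σ h v := by
    obtain ⟨g, rfl⟩ := QuotientGroup.mk_surjective h
    exact Subtype.ext (SymPair.map_smul (σ : K →+* K) g v.1)

/-- The natural map `G_f → H_f` of descended stabilizers for `G = SL_n` and `H = SL_n / μ₂`. -/
def stabMap (f : Fin (n + 1) → k) (K : Type*) [Field K] [Algebra k K] :
    DescStab (SL n K) (fiber f K) →* DescStab (SLmodMu2 n K) (fiber f K) :=
  DescStab.map (QuotientGroup.mk' (scalarMu2 n K)) (QuotientGroup.mk'_surjective _)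
    fun _ _ => rfl

lemma stabMap_smul (f : Fin (n + 1) → k) (σ : Gal(K/k)) (b : DescStab (SL n K) (fiber f K)) :
    stabMap f K (σ • b) = σ • stabMap f K b :=
  DescStab.map_smul _ _ _ (fun _ _ => rfl) σ b

end Forms

end PairsOfForms

/-! For a pair `(A, B)` in the fiber, `T = A⁻¹B` is self-adjoint for `A` and has characteristic
polynomial `g`, which is separable because the discriminant is nonzero. Hence `T` is diagonalizable
over `K` with distinct eigenvalues, and its centralizer over any `E` consists of the `p(T)`, a copy
of `E ⊗ L` in which determinant is norm. An element fixing both forms fixes `T`, so it is some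
`x(T)`; self-adjointness turns `xᵗAx = A` into `x² = 1`, and determinant one into norm one. This
gives `R0 ≅ G_v` (`R0.toSL_smul`, `R0.exists_toSL_eq`); scalars correspond to scalars, so the
quotients by `μ₂` match as well. Since `T` is conjugated by `g` when `v` is moved by `g`, the
isomorphisms form a descended family.

Transitivity over `K` (`fiber_exists_smul_eq`): eigenvectors of `T` are orthogonal for `A`, and
square roots exist, so every pair becomes `(1, diag r)` in a suitable basis; a sign correction
brings the change of basis into `SL_n`. Transitivity makes a descended family determined by one
value, and the obstruction class independent of choices (`HasDescent.class_unique`).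

The class is then computed at one well chosen point (`isObstructionClass_connecting`). Over `k`, the
form "coefficient of `β^(n-1)` in `xy`", paired with multiplication by `β`, has invariant form `f /
f₀`. Take `w` in `K ⊗ L` of norm `s = √f₀` and multiply both forms by `w²`: the result lies in the
fiber. With `b_σ` of square one and norm `σ(s)/s`, the element `y_σ = σ(w) w⁻¹ b_σ` has norm one and
carries the conjugate pair back to the original one. The factor `σ(w)/w` is a coboundary, so the
obstruction cocycle of `y` is the coboundary of `b`, that is, the cocycle defining `δ₀(f₀)`. The
assertion for `H` follows by pushing the same `g_σ` forward (`IsObstructionClass.map`). -/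

namespace PairsOfForms

/-! ### Evaluation of elements of `E ⊗ L` at roots of the defining polynomial -/

section Evaluation

open Polynomial

variable {k : Type*} [Field k] {n : ℕ} {f : Fin (n + 1) → k}
variable {E : Type*} [CommRing E] [Algebra k E]

/-- The `k`-algebra map `L → S` sending `β` to a root `s` of the monic polynomial of `f`. -/
noncomputable def liftBeta {S : Type*} [Ring S] [Algebra k S]
    (s : S) (hs : aeval s (monicPoly f) = 0) : AlgL f →ₐ[k] S :=
  Ideal.Quotient.liftₐ (Ideal.span {monicPoly f}) (aeval s) (by
    intro a ha
    obtain ⟨c, rfl⟩ := Ideal.mem_span_singleton.1 ha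
    rw [map_mul, hs, zero_mul])

lemma liftBeta_root {S : Type*} [Ring S] [Algebra k S] (s : S)
    (hs : aeval s (monicPoly f) = 0) : liftBeta s hs (AdjoinRoot.root (monicPoly f)) = s :=
  (Ideal.Quotient.lift_mk (Ideal.span {monicPoly f}) _ _).trans (aeval_X s)

variable {S : Type*} [Ring S] [Algebra k S] [Algebra E S] [IsScalarTower k E S]

/-- The `E`-algebra map `E ⊗ L → S` sending `β` to a root `s` of the monic polynomial of `f`. -/
noncomputable def evalAt (s : S) (hs : aeval s (monicPoly f) = 0) : E ⊗[k] AlgL f →ₐ[E] S :=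
  Algebra.TensorProduct.lift (Algebra.ofId E S) (liftBeta s hs)
    fun e _ => Algebra.commute_algebraMap_left e _

lemma evalAt_root (s : S) (hs : aeval s (monicPoly f) = 0) :
    evalAt (E := E) s hs ((1 : E) ⊗ₜ[k] AdjoinRoot.root (monicPoly f)) = s := by
  refine (Algebra.TensorProduct.lift_tmul _ _ _ _ _).trans ?_
  rw [map_one, one_mul, liftBeta_root]

lemma evalAt_evalBeta (s : S) (hs : aeval s (monicPoly f) = 0) (p : E[X]) :
    evalAt s hs (evalBeta f p) = aeval s p := by
  rw [evalBeta, ← aeval_algHom_apply, evalAt_root]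

/-- Reduces every later identity on `E ⊗ L` to one about polynomials evaluated at `β`. -/
lemma evalBeta_surjective (x : E ⊗[k] AlgL f) : ∃ p : E[X], evalBeta f p = x := by
  induction x using TensorProduct.induction_on with
  | zero => exact ⟨0, map_zero _⟩
  | add x y hx hy =>
    obtain ⟨p, rfl⟩ := hx
    obtain ⟨q, rfl⟩ := hy
    exact ⟨p + q, map_add _ _ _⟩
  | tmul e l =>
    obtain ⟨q, rfl⟩ := AdjoinRoot.mk_surjective l
    refine ⟨C e * q.map (algebraMap k E), ?_⟩
    have h1 : evalBeta f (q.map (algebraMap k E)) = (1 : E) ⊗ₜ[k] AdjoinRoot.mk _ q := by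
      rw [evalBeta, aeval_map_algebraMap, ← AdjoinRoot.aeval_eq]
      exact aeval_algHom_apply
        (Algebra.TensorProduct.includeRight : AlgL f →ₐ[k] E ⊗[k] AlgL f) _ q
    have h2 : evalBeta f (C e * q.map (algebraMap k E)) =
        algebraMap E _ e * evalBeta f (q.map (algebraMap k E)) := by
      rw [evalBeta, map_mul, aeval_C]
      rfl
    rw [h2, h1, Algebra.TensorProduct.algebraMap_apply]
    simp

lemma monicPoly_natDegree (f : Fin (n + 1) → k) : (monicPoly f).natDegree = n := by
  rw [monicPoly, natDegree_add_eq_left_of_degree_lt, natDegree_X_pow]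
  rw [degree_X_pow]
  refine (degree_sum_le _ _).trans_lt ((Finset.sup_lt_iff (WithBot.bot_lt_coe n)).2 ?_)
  intro i _
  refine (degree_C_mul_X_pow_le _ _).trans_lt ?_
  exact WithBot.coe_lt_coe.2 (by omega : n - (i + 1 : ℕ) < n)

/-- The basis `1, β, …, β^(n-1)` of `L`. -/
noncomputable def betaBasis (f : Fin (n + 1) → k) : Module.Basis (Fin n) k (AlgL f) :=
  (AdjoinRoot.powerBasis' (monicPoly_monic f)).basis.reindex
    (finCongr ((AdjoinRoot.powerBasis'_dim _).trans (monicPoly_natDegree f)))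

lemma betaBasis_apply (f : Fin (n + 1) → k) (i : Fin n) :
    betaBasis f i = AdjoinRoot.root (monicPoly f) ^ (i : ℕ) := by
  rw [betaBasis, Module.Basis.reindex_apply, PowerBasis.basis_eq_pow, AdjoinRoot.powerBasis'_gen]
  rfl

/-! ### Splitting `E ⊗ L` as `Eⁿ` by the roots of `g`. -/

variable {K : Type*} [Field K] [Algebra k K]

/-- A numbering `r` of `n` distinct roots in `K` of the monic polynomial of `f`. -/
structure IsRootSystem (f : Fin (n + 1) → k) (r : Fin n → K) : Prop where
  injective : Function.Injective r
  isRoot : ∀ i, aeval (r i) (monicPoly f) = 0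

lemma IsRootSystem.aeval_comp {r : Fin n → K} (hr : IsRootSystem f r) (φ : K →ₐ[k] E) :
    aeval (fun i => φ (r i)) (monicPoly f) = 0 := by
  ext i
  have := congrArg φ (hr.isRoot i)
  rw [map_zero, ← aeval_algHom_apply] at this
  rw [Pi.zero_apply, ← this]
  exact (aeval_algHom_apply (Pi.evalAlgHom k (fun _ : Fin n => E) i) _ _).symm

/-- The simultaneous evaluation `E ⊗ L → Eⁿ` at the roots `r i`. -/
noncomputable def evalRoots {r : Fin n → K} (hr : IsRootSystem f r) (φ : K →ₐ[k] E) :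
    E ⊗[k] AlgL f →ₐ[E] (Fin n → E) :=
  evalAt (fun i => φ (r i)) (hr.aeval_comp φ)

lemma evalRoots_evalBeta {r : Fin n → K} (hr : IsRootSystem f r) (φ : K →ₐ[k] E) (p : E[X]) :
    evalRoots hr φ (evalBeta f p) = fun i => p.eval (φ (r i)) := by
  rw [evalRoots, evalAt_evalBeta]
  ext i
  rw [← coe_aeval_eq_eval]
  exact (aeval_algHom_apply (Pi.evalAlgHom E (fun _ : Fin n => E) i) _ _).symm

/-- Lagrange interpolation. The basis polynomials are formed over the field `K`, where root
differences are invertible, and only then carried to the ring `E`. -/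
lemma evalRoots_surjective {r : Fin n → K} (hr : IsRootSystem f r) (φ : K →ₐ[k] E) :
    Function.Surjective (evalRoots hr φ) := by
  intro c
  refine ⟨∑ j, c j • evalBeta f ((Lagrange.basis Finset.univ r j).map (φ : K →+* E)), ?_⟩
  rw [map_sum]
  ext i
  simp only [map_smul, evalRoots_evalBeta, Finset.sum_apply, Pi.smul_apply]
  rw [Finset.sum_eq_single i]
  · have := eval_map_apply (f := (φ : K →+* E)) (p := Lagrange.basis Finset.univ r i) (r i)
    rw [Lagrange.eval_basis_self hr.injective.injOn (Finset.mem_univ i), map_one] at this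
    rw [show φ (r i) = (φ : K →+* E) (r i) from rfl, this]
    simp
  · intro j _ hj
    have := eval_map_apply (f := (φ : K →+* E)) (p := Lagrange.basis Finset.univ r j) (r i)
    rw [Lagrange.eval_basis_of_ne hj (Finset.mem_univ i), map_zero] at this
    rw [show φ (r i) = (φ : K →+* E) (r i) from rfl, this]
    simp
  · simp

/-- Both sides are free of rank `n` over `E`, and a surjective endomorphism of a finite module over
a commutative ring is injective. -/
lemma evalRoots_bijective {r : Fin n → K} (hr : IsRootSystem f r) (φ : K →ₐ[k] E) :
    Function.Bijective (evalRoots hr φ) := by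
  refine ⟨?_, evalRoots_surjective hr φ⟩
  let e := (Algebra.TensorProduct.basis E (betaBasis f)).equivFun
  have h : Function.Injective ((evalRoots hr φ).toLinearMap ∘ₗ e.symm.toLinearMap) :=
    OrzechProperty.injective_of_surjective_endomorphism _
      ((evalRoots_surjective hr φ).comp e.symm.surjective)
  intro x y hxy
  have := @h (e x) (e y) (by simpa using hxy)
  exact e.injective this

/-- `E ⊗ L ≃ Eⁿ`. -/
noncomputable def evalRootsEquiv {r : Fin n → K} (hr : IsRootSystem f r) (φ : K →ₐ[k] E) :
    E ⊗[k] AlgL f ≃ₐ[E] (Fin n → E) :=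
  AlgEquiv.ofBijective (evalRoots hr φ) (evalRoots_bijective hr φ)

lemma norm_pi_eq_prod {ι : Type*} [Fintype ι] (c : ι → E) :
    Algebra.norm E c = ∏ i, c i := by
  classical
  rw [Algebra.norm_eq_matrix_det (Pi.basisFun E ι)]
  have : Algebra.leftMulMatrix (Pi.basisFun E ι) c = Matrix.diagonal c := by
    ext i j
    rw [Algebra.leftMulMatrix_eq_repr_mul]
    by_cases h : i = j
    · subst h; simp
    · simp [h]
  rw [this, Matrix.det_diagonal]

lemma norm_eq_prod_evalRoots {r : Fin n → K} (hr : IsRootSystem f r) (φ : K →ₐ[k] E)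
    (x : E ⊗[k] AlgL f) : Algebra.norm E x = ∏ i, evalRoots hr φ x i := by
  rw [← Algebra.norm_eq_of_algEquiv (evalRootsEquiv hr φ), norm_pi_eq_prod]
  rfl

/-! ### Diagonalization -/

/-- `P` and its inverse `Q` diagonalize `M`, with eigenvalues `r`. -/
structure IsDiagonalization (M : Matrix (Fin n) (Fin n) K) (r : Fin n → K)
    (P Q : Matrix (Fin n) (Fin n) K) : Prop where
  mul_inv : P * Q = 1
  inv_mul : Q * P = 1
  mul_eq : M * P = P * Matrix.diagonal r

/-- An intertwining relation passes to all polynomials. It serves three times: for diagonalization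
(`c = P`), for adjoints (`c = A`) and for conjugation by a group element (`c = g`). -/
lemma aeval_mul_eq_mul_aeval {A : Type*} [Ring A] [Algebra E A] {a b c : A} (h : a * c = c * b)
    (p : E[X]) : aeval a p * c = c * aeval b p := by
  induction p using Polynomial.induction_on' with
  | add p q hp hq => rw [map_add, map_add, add_mul, mul_add, hp, hq]
  | monomial m e =>
    have hm : a ^ m * c = c * b ^ m := by
      have : SemiconjBy c b a := h.symm
      exact (this.pow_right m).eq.symm
    rw [aeval_monomial, aeval_monomial, mul_assoc, hm, ← mul_assoc, Algebra.commutes, mul_assoc]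

variable {M P Q : Matrix (Fin n) (Fin n) K} {r : Fin n → K}

lemma map_mul_map_eq_one (φ : K →ₐ[k] E) (h : P * Q = 1) : P.map φ * Q.map φ = 1 := by
  have := congrArg (fun N : Matrix (Fin n) (Fin n) K => N.map (φ : K →+* E)) h
  simp only [Matrix.map_mul] at this
  refine this.trans ?_
  simp

lemma IsDiagonalization.evalAt_mul (hM : IsDiagonalization M r P Q) (hr : IsRootSystem f r)
    (φ : K →ₐ[k] E) (hφ : aeval (M.map φ) (monicPoly f) = 0) (x : E ⊗[k] AlgL f) :
    evalAt (M.map φ) hφ x * P.map φ = P.map φ * Matrix.diagonal (evalRoots hr φ x) := by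
  obtain ⟨p, rfl⟩ := evalBeta_surjective x
  have h : M.map φ * P.map φ = P.map φ * Matrix.diagonal fun i => φ (r i) := by
    have := congrArg (fun N : Matrix (Fin n) (Fin n) K => N.map (φ : K →+* E)) hM.mul_eq
    simp only [Matrix.map_mul] at this
    refine this.trans ?_
    congr 1
    exact Matrix.diagonal_map (map_zero φ)
  rw [evalAt_evalBeta, aeval_mul_eq_mul_aeval h]
  congr 1
  rw [evalRoots, evalAt_evalBeta]
  exact aeval_algHom_apply (Matrix.diagonalAlgHom (n := Fin n) (α := E) E) _ p

lemma IsDiagonalization.evalAt_injective (hM : IsDiagonalization M r P Q) (hr : IsRootSystem f r)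
    (φ : K →ₐ[k] E) (hφ : aeval (M.map φ) (monicPoly f) = 0) :
    Function.Injective (evalAt (E := E) (M.map φ) hφ) := by
  rw [injective_iff_map_eq_zero]
  intro x hx
  have h := hM.evalAt_mul hr φ hφ x
  rw [hx, zero_mul] at h
  have h' := congrArg (fun N => Q.map φ * N) h
  simp only [← mul_assoc, map_mul_map_eq_one φ hM.inv_mul, one_mul, mul_zero] at h'
  apply (evalRoots_bijective hr φ).1
  rw [map_zero]
  exact Matrix.diagonal_injective (h'.symm.trans Matrix.diagonal_zero.symm)

lemma IsDiagonalization.det_evalAt (hM : IsDiagonalization M r P Q) (hr : IsRootSystem f r)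
    (φ : K →ₐ[k] E) (hφ : aeval (M.map φ) (monicPoly f) = 0) (x : E ⊗[k] AlgL f) :
    (evalAt (M.map φ) hφ x).det = Algebra.norm E x := by
  have h := congrArg (fun N => (N * Q.map φ).det) (hM.evalAt_mul hr φ hφ x)
  simp only [mul_assoc, map_mul_map_eq_one φ hM.mul_inv, mul_one] at h
  have hd := congrArg Matrix.det (map_mul_map_eq_one φ hM.mul_inv)
  rw [Matrix.det_mul, Matrix.det_one] at hd
  rw [h, Matrix.det_mul, Matrix.det_mul, Matrix.det_diagonal, mul_left_comm, hd, mul_one,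
    norm_eq_prod_evalRoots hr φ]

/-- The `(i, j)` entry of the commutator is `(d i - d j)` times that of `N`, up to sign. Over a ring
the differences must be units, not merely nonzero; for images of distinct elements of a field they
are. -/
lemma eq_diagonal_of_commute {d : Fin n → E} (hd : ∀ i j, i ≠ j → IsUnit (d i - d j))
    {N : Matrix (Fin n) (Fin n) E} (h : N * Matrix.diagonal d = Matrix.diagonal d * N) :
    N = Matrix.diagonal fun i => N i i := by
  ext i j
  by_cases hij : i = j
  · subst hij; simp
  · have := congrFun (congrFun h i) j
    rw [Matrix.mul_diagonal, Matrix.diagonal_mul] at this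
    rw [Matrix.diagonal_apply_ne _ hij]
    refine (hd i j hij).mul_right_eq_zero.1 ?_
    rw [sub_mul, ← this]
    ring

/-- The centralizer of a matrix with distinct eigenvalues is its polynomial algebra: in the
eigenbasis `N` becomes diagonal, and any diagonal is interpolated by an element of `E ⊗ L`. -/
lemma IsDiagonalization.exists_evalAt_eq (hM : IsDiagonalization M r P Q) (hr : IsRootSystem f r)
    (φ : K →ₐ[k] E) (hφ : aeval (M.map φ) (monicPoly f) = 0) {N : Matrix (Fin n) (Fin n) E}
    (hN : N * M.map φ = M.map φ * N) : ∃ x, evalAt (E := E) (M.map φ) hφ x = N := by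
  have hPQ := map_mul_map_eq_one φ hM.mul_inv
  have hQP := map_mul_map_eq_one φ hM.inv_mul
  have h : M.map φ * P.map φ = P.map φ * Matrix.diagonal fun i => φ (r i) := by
    have := hM.evalAt_mul hr φ hφ ((1 : E) ⊗ₜ[k] AdjoinRoot.root (monicPoly f))
    rwa [evalAt_root, evalRoots, evalAt_root] at this
  have hd : Q.map φ * M.map φ = (Matrix.diagonal fun i => φ (r i)) * Q.map φ := by
    calc Q.map φ * M.map φ = Q.map φ * (M.map φ * P.map φ) * Q.map φ := by
          rw [mul_assoc, mul_assoc, hPQ, mul_one]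
      _ = _ := by rw [h, ← mul_assoc, hQP, one_mul]
  have hc : (Q.map φ * N * P.map φ) * (Matrix.diagonal fun i => φ (r i)) =
      (Matrix.diagonal fun i => φ (r i)) * (Q.map φ * N * P.map φ) := by
    rw [mul_assoc, ← h, ← mul_assoc, mul_assoc _ N, hN, ← mul_assoc, ← mul_assoc, ← mul_assoc, hd]
  have hu : ∀ i j : Fin n, i ≠ j → IsUnit (φ (r i) - φ (r j)) := fun i j hij => by
    rw [← map_sub]
    exact (IsUnit.mk0 _ (sub_ne_zero.2 (hr.injective.ne hij))).map φ
  obtain ⟨x, hx⟩ := evalRoots_surjective hr φ fun i => (Q.map φ * N * P.map φ) i i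
  refine ⟨x, ?_⟩
  have := hM.evalAt_mul hr φ hφ x
  rw [hx, ← eq_diagonal_of_commute hu hc, mul_assoc, ← mul_assoc, hPQ, one_mul] at this
  have h' := congrArg (fun N => N * Q.map φ) this
  simpa only [mul_assoc, hPQ, mul_one] using h'

lemma exists_isDiagonalization (hr : IsRootSystem f r)
    (hM : M.charpoly = (monicPoly f).map (algebraMap k K)) :
    ∃ P Q, IsDiagonalization M r P Q := by
  have hev : ∀ i, ∃ w : Fin n → K, Module.End.HasEigenvector (Matrix.toLin' M) (r i) w := by
    intro i
    apply Module.End.HasEigenvalue.exists_hasEigenvector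
    rw [Module.End.hasEigenvalue_iff_isRoot_charpoly, Matrix.charpoly_toLin', hM, IsRoot.def,
      eval_map_algebraMap]
    exact hr.isRoot i
  choose w hw using hev
  have hli : LinearIndependent K w :=
    Module.End.eigenvectors_linearIndependent' _ r hr.injective w hw
  have hu : IsUnit (Matrix.of w) := Matrix.linearIndependent_rows_iff_isUnit.1 hli
  have hu' : IsUnit (Matrix.of w).transpose := (Matrix.isUnit_transpose _).2 hu
  rw [Matrix.isUnit_iff_isUnit_det] at hu'
  refine ⟨_, _, Matrix.mul_nonsing_inv _ hu', Matrix.nonsing_inv_mul _ hu', ?_⟩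
  ext i j
  have := congrFun (hw j).apply_eq_smul i
  rw [Matrix.mul_diagonal]
  rw [Matrix.toLin'_apply] at this
  simpa [Matrix.mul_apply, Matrix.mulVec, dotProduct, mul_comm] using this

end Evaluation

/-! ### Pairs of forms with a given invariant binary form -/

section Pairs

open Polynomial

variable {n : ℕ} {E : Type*} [CommRing E]

lemma SymPair.smul_A (g : SL n E) (w : SymPair n E) :
    (g • w).A = ((g⁻¹ : SL n E) : Matrix (Fin n) (Fin n) E).transpose * w.A *
      ((g⁻¹ : SL n E) : Matrix (Fin n) (Fin n) E) := rfl

lemma SymPair.smul_B (g : SL n E) (w : SymPair n E) :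
    (g • w).B = ((g⁻¹ : SL n E) : Matrix (Fin n) (Fin n) E).transpose * w.B *
      ((g⁻¹ : SL n E) : Matrix (Fin n) (Fin n) E) := rfl

lemma coe_mul_coe_inv (g : SL n E) :
    (g : Matrix (Fin n) (Fin n) E) * ((g⁻¹ : SL n E) : Matrix (Fin n) (Fin n) E) = 1 := by
  rw [← Matrix.SpecialLinearGroup.coe_mul, mul_inv_cancel, Matrix.SpecialLinearGroup.coe_one]

lemma coe_inv_mul_coe (g : SL n E) :
    ((g⁻¹ : SL n E) : Matrix (Fin n) (Fin n) E) * (g : Matrix (Fin n) (Fin n) E) = 1 := by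
  rw [← Matrix.SpecialLinearGroup.coe_mul, inv_mul_cancel, Matrix.SpecialLinearGroup.coe_one]

lemma transpose_conj_eq_iff {G H M N : Matrix (Fin n) (Fin n) E} (h : G * H = 1) (h' : H * G = 1) :
    H.transpose * M * H = N ↔ M = G.transpose * N * G := by
  have ht : G.transpose * H.transpose = 1 := by rw [← Matrix.transpose_mul, h', Matrix.transpose_one]
  have ht' : H.transpose * G.transpose = 1 := by rw [← Matrix.transpose_mul, h, Matrix.transpose_one]
  constructor
  · rintro rfl
    rw [mul_assoc, mul_assoc, mul_assoc, h', mul_one, ← mul_assoc, ht, one_mul]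
  · rintro rfl
    rw [mul_assoc, mul_assoc, mul_assoc, h, mul_one, ← mul_assoc, ht', one_mul]

/-- The action is through `g⁻¹`; this form of the condition is free of inverses. -/
lemma SymPair.smul_eq_iff (g : SL n E) (w w' : SymPair n E) :
    g • w = w' ↔
      w.A = (g : Matrix (Fin n) (Fin n) E).transpose * w'.A * (g : Matrix (Fin n) (Fin n) E) ∧
      w.B = (g : Matrix (Fin n) (Fin n) E).transpose * w'.B * (g : Matrix (Fin n) (Fin n) E) := by
  rw [SymPair.ext_iff, SymPair.smul_A, SymPair.smul_B,
    transpose_conj_eq_iff (coe_mul_coe_inv g) (coe_inv_mul_coe g),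
    transpose_conj_eq_iff (coe_mul_coe_inv g) (coe_inv_mul_coe g)]

lemma SymPair.A_mul_T {w : SymPair n E} (hA : IsUnit w.A.det) : w.A * w.T = w.B := by
  rw [SymPair.T, ← mul_assoc, Matrix.mul_nonsing_inv _ hA, one_mul]

/-- `A` and `B` transform as forms, so `A⁻¹B` transforms as an operator. -/
lemma SymPair.T_smul (g : SL n E) {w : SymPair n E} (hA : IsUnit w.A.det) :
    (g • w).T = (g : Matrix (Fin n) (Fin n) E) * w.T *
      ((g⁻¹ : SL n E) : Matrix (Fin n) (Fin n) E) := by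
  have hA' : IsUnit (g • w).A.det := by
    rw [SymPair.smul_A, Matrix.det_mul, Matrix.det_mul, Matrix.det_transpose,
      Matrix.SpecialLinearGroup.det_coe, one_mul, mul_one]
    exact hA
  have h := SymPair.A_mul_T hA'
  have key : (g • w).A * ((g : Matrix (Fin n) (Fin n) E) * w.T *
      ((g⁻¹ : SL n E) : Matrix (Fin n) (Fin n) E)) = (g • w).B := by
    rw [SymPair.smul_A, SymPair.smul_B, ← SymPair.A_mul_T hA]
    simp only [mul_assoc]
    rw [← mul_assoc _ (g : Matrix (Fin n) (Fin n) E), coe_inv_mul_coe, one_mul]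
  rw [← key] at h
  exact ((Matrix.isUnit_iff_isUnit_det _).2 hA').mul_right_inj.1 h

lemma SymPair.T_map {E' : Type*} [CommRing E'] (ψ : E →+* E') {w : SymPair n E}
    (hA : IsUnit w.A.det) : (w.map ψ).T = w.T.map ψ := by
  have hA' : IsUnit (w.map ψ).A.det := by
    have : (w.map ψ).A.det = ψ w.A.det := (ψ.map_det w.A).symm
    rw [this]
    exact hA.map ψ
  have h := SymPair.A_mul_T hA'
  have key : (w.map ψ).A * w.T.map ψ = (w.map ψ).B := by
    change w.A.map ψ * w.T.map ψ = w.B.map ψ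
    rw [← Matrix.map_mul, SymPair.A_mul_T hA]
  rw [← key] at h
  exact ((Matrix.isUnit_iff_isUnit_det _).2 hA').mul_right_inj.1 h

/-- `T = A⁻¹ B` is self-adjoint with respect to `A`. -/
lemma SymPair.transpose_T_mul_A {w : SymPair n E} (hA : IsUnit w.A.det) :
    w.T.transpose * w.A = w.A * w.T := by
  have h := congrArg Matrix.transpose (SymPair.A_mul_T hA)
  rw [Matrix.transpose_mul, w.symmA.eq, w.symmB.eq] at h
  rw [h, SymPair.A_mul_T hA]

/-- Polynomials in a self-adjoint operator are self-adjoint. -/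
lemma transpose_aeval_mul {A T : Matrix (Fin n) (Fin n) E} (h : T.transpose * A = A * T)
    (p : E[X]) : (aeval T p).transpose * A = A * aeval T p := by
  have : (aeval T p).transpose = aeval T.transpose p := by
    -- Transposition is an algebra map only into the opposite algebra, hence the passage through
    -- `MulOpposite.unop`.
    have h := aeval_algHom_apply (Matrix.transposeAlgEquiv (Fin n) E E).toAlgHom T p
    have h2 := congrArg MulOpposite.unop h
    refine Eq.trans h2.symm ?_
    rw [aeval_eq_sum_range, aeval_eq_sum_range]
    simp
  rw [this]
  exact aeval_mul_eq_mul_aeval h p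

/-! ### Membership in the fiber in terms of `det A` and the characteristic polynomial of `T`. -/

variable {k : Type*} [Field k] [Algebra k E] {f : Fin (n + 1) → k}

/-- Specialize the defining identity at `(x, y) = (1, 0)`. -/
lemma det_A_of_mem_fiber {w : SymPair n E} (hw : w ∈ fiber f E) :
    (-1) ^ (n * (n - 1) / 2) * w.A.det = algebraMap k E (f 0) := by
  have h := congrArg (MvPolynomial.eval (![1, 0] : Fin 2 → E)) hw
  rw [map_mul, RingHom.map_det, map_pow, map_neg, map_one] at h
  have hM : (MvPolynomial.eval (![1, 0] : Fin 2 → E)).mapMatrix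
      ((MvPolynomial.X 0 : MvPolynomial (Fin 2) E) • w.A.map MvPolynomial.C -
        (MvPolynomial.X 1 : MvPolynomial (Fin 2) E) • w.B.map MvPolynomial.C) = w.A := by
    ext i j
    simp
  rw [hM] at h
  rw [h, binaryForm, Fin.sum_univ_succ, map_add, map_add, map_sum, map_sum, Finset.sum_eq_zero]
  · simp
  · intro i _
    simp

lemma isUnit_det_A {w : SymPair n E} (hw : w ∈ fiber f E) (hf0 : f 0 ≠ 0) : IsUnit w.A.det := by
  have h : IsUnit (algebraMap k E (f 0)) := (IsUnit.mk0 _ hf0).map _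
  rw [← det_A_of_mem_fiber hw] at h
  exact isUnit_of_mul_isUnit_right h

lemma map_mul_charmatrix {A B T : Matrix (Fin n) (Fin n) E} (h : A * T = B) :
    A.map C * T.charmatrix = (X : E[X]) • A.map C - B.map C := by
  rw [Matrix.charmatrix, mul_sub, ← h, Matrix.map_mul]
  congr 1
  rw [Matrix.scalar_apply, ← Matrix.smul_one_eq_diagonal, mul_smul_comm, mul_one]

/-- Specialize at `(x, y) = (X, 1)`: then `XA - B = A (X - T)`, while `f(X, 1) = f₀ g`. The sign and
`det A` are units and cancel. -/
lemma charpoly_T_of_mem_fiber {w : SymPair n E} (hw : w ∈ fiber f E) (hf0 : f 0 ≠ 0) :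
    w.T.charpoly = (monicPoly f).map (algebraMap k E) := by
  have h := congrArg (MvPolynomial.aeval (R := E) (![X, 1] : Fin 2 → E[X])) hw
  rw [map_mul, AlgHom.map_det, map_pow, map_neg, map_one] at h
  have hM : (MvPolynomial.aeval (R := E) (![X, 1] : Fin 2 → E[X])).mapMatrix
      ((MvPolynomial.X 0 : MvPolynomial (Fin 2) E) • w.A.map MvPolynomial.C -
        (MvPolynomial.X 1 : MvPolynomial (Fin 2) E) • w.B.map MvPolynomial.C) =
      (X : E[X]) • w.A.map C - w.B.map C := by
    ext1 i j
    simp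
  have hb : MvPolynomial.aeval (R := E) (![X, 1] : Fin 2 → E[X])
      (MvPolynomial.map (algebraMap k E) (binaryForm f)) =
      (dehomogenization f).map (algebraMap k E) := by
    rw [binaryForm, dehomogenization, map_sum, map_sum, Polynomial.map_sum]
    refine Finset.sum_congr rfl fun i _ => ?_
    simp
  have hA := det_A_of_mem_fiber hw
  have hdet : (w.A.map (C : E → E[X])).det = C w.A.det := ((C : E →+* E[X]).map_det w.A).symm
  rw [hM, hb, ← map_mul_charmatrix (SymPair.A_mul_T (isUnit_det_A hw hf0)), Matrix.det_mul,
    dehomogenization_eq f hf0, Polynomial.map_mul, map_C, ← hA, hdet, C_mul, C_pow, C_neg, C_1,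
    mul_assoc, ← Matrix.charpoly] at h
  have hu : IsUnit ((-1 : E[X]) ^ (n * (n - 1) / 2)) := (isUnit_one.neg).pow _
  have hu' : IsUnit (C w.A.det : E[X]) := (isUnit_det_A hw hf0).map C
  exact hu'.mul_right_inj.1 (hu.mul_right_inj.1 h)

lemma aeval_T_of_mem_fiber {w : SymPair n E} (hw : w ∈ fiber f E) (hf0 : f 0 ≠ 0) :
    aeval w.T (monicPoly f) = 0 := by
  have h := w.T.aeval_self_charpoly
  rwa [charpoly_T_of_mem_fiber hw hf0, aeval_map_algebraMap] at h

/-- The binary form is determined by its dehomogenization. -/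
lemma mem_fiber_of_charpoly {K : Type*} [Field K] [Algebra k K] (hf0 : f 0 ≠ 0) {w : SymPair n K}
    {T : Matrix (Fin n) (Fin n) K} (hT : w.A * T = w.B)
    (hA : (-1) ^ (n * (n - 1) / 2) * w.A.det = algebraMap k K (f 0))
    (hc : T.charpoly = (monicPoly f).map (algebraMap k K)) : w ∈ fiber f K := by
  -- The identity is checked in a field containing `K[x, y]`. There `y` is invertible, and a
  -- polynomial `h` of degree at most `n` is homogenized as `yⁿ h(x / y)`.
  obtain ⟨F, _, a, ha⟩ : ∃ (F : Type _) (_ : Field F) (a : MvPolynomial (Fin 2) K →+* F),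
      Function.Injective a :=
    ⟨FractionRing (MvPolynomial (Fin 2) K), inferInstance, algebraMap _ _,
      IsFractionRing.injective _ _⟩
  have hy : a (MvPolynomial.X 1) ≠ 0 := by
    rw [Ne, map_eq_zero_iff a ha]
    exact MvPolynomial.X_ne_zero _
  set x := a (MvPolynomial.X 0) with hx_def
  set y := a (MvPolynomial.X 1) with hy_def
  let c : K →+* F := a.comp MvPolynomial.C
  have h1 : (X : K[X]) • w.A.map C - w.B.map C = w.A.map C * T.charmatrix :=
    (map_mul_charmatrix hT).symm
  have h2 := congrArg (fun N : Matrix (Fin n) (Fin n) K[X] =>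
    (-1) ^ (n * (n - 1) / 2) * (y ^ n * eval₂ c (x / y) N.det)) h1
  have hdet : (w.A.map (C : K → K[X])).det = C w.A.det := ((C : K →+* K[X]).map_det w.A).symm
  have hL : y ^ n * eval₂ c (x / y) ((X : K[X]) • w.A.map C - w.B.map C).det =
      (x • w.A.map c - y • w.B.map c).det := by
    have := (eval₂RingHom c (x / y)).map_det ((X : K[X]) • w.A.map C - w.B.map C)
    rw [coe_eval₂RingHom] at this
    rw [this]
    have h3 := Matrix.det_smul ((eval₂RingHom c (x / y)).mapMatrix
      ((X : K[X]) • w.A.map C - w.B.map C)) y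
    rw [Fintype.card_fin] at h3
    rw [← h3]
    congr 1
    ext i j
    simp only [RingHom.mapMatrix_apply, Matrix.smul_apply, Matrix.map_apply, Matrix.sub_apply,
      smul_eq_mul, map_sub, coe_eval₂RingHom, eval₂_mul, eval₂_X, eval₂_C]
    rw [mul_sub, ← mul_assoc, mul_div_cancel₀ _ hy]
  have hR : (-1) ^ (n * (n - 1) / 2) * (y ^ n * eval₂ c (x / y) (w.A.map C * T.charmatrix).det) =
      a (MvPolynomial.map (algebraMap k K) (binaryForm f)) := by
    have h4 : eval₂ c (x / y) ((dehomogenization f).map (algebraMap k K)) =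
        (-1) ^ (n * (n - 1) / 2) * eval₂ c (x / y) (w.A.map C * T.charmatrix).det := by
      rw [dehomogenization_eq f hf0, Matrix.det_mul, ← Matrix.charpoly, hc, Polynomial.map_mul,
        map_C, ← hA, hdet]
      simp only [eval₂_mul, eval₂_C, eval₂_pow, eval₂_neg, eval₂_one, map_mul, map_pow, map_neg,
        map_one]
      ring
    rw [mul_left_comm, ← h4, dehomogenization, binaryForm, Polynomial.map_sum, eval₂_finsetSum,
      map_sum, map_sum, Finset.mul_sum]
    refine Finset.sum_congr rfl fun i _ => ?_
    have hi : (i : ℕ) ≤ n := by omega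
    simp only [Polynomial.map_mul, map_C, Polynomial.map_pow, map_X, eval₂_mul, eval₂_C, eval₂_pow,
      eval₂_X, map_mul, map_pow, MvPolynomial.map_C, MvPolynomial.map_X]
    rw [← hx_def, ← hy_def]
    change y ^ n * (c _ * _) = c _ * _ * _
    have hy' : y ^ n = y ^ (i : ℕ) * y ^ (n - (i : ℕ)) := by rw [← pow_add, Nat.add_sub_cancel' hi]
    rw [hy', div_pow]
    field_simp
  rw [hL, hR] at h2
  apply ha
  rw [map_mul, map_pow, map_neg, map_one, RingHom.map_det, ← h2]
  congr 2
  ext i j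
  simp [c, hx_def, hy_def]

end Pairs

/-! ### The stabilizers -/

section Stabilizers

open Polynomial

variable {k : Type*} [Field k] {n : ℕ} {f : Fin (n + 1) → k}
variable {K : Type*} [Field K] [Algebra k K]

lemma val_sq_eq_one {E : Type*} [CommRing E] [Algebra k E] {L : Type*} [CommRing L] [Algebra k L]
    (x : R0 k L E) : (x.1.1 : E ⊗[k] L) * x.1.1 = 1 := by
  have h : x.1.1 ^ 2 = 1 := x.1.2
  rw [← Units.val_mul, ← sq, h, Units.val_one]

lemma norm_eq_one {E : Type*} [CommRing E] [Algebra k E] {L : Type*} [CommRing L] [Algebra k L]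
    (x : R0 k L E) : Algebra.norm E (x.1.1 : E ⊗[k] L) = 1 :=
  congrArg (fun y : rootsOfUnity 2 E => (y.1 : E)) x.2

/-- An element of `(Res μ₂)_{N = 1}` from an element of square and norm one. -/
noncomputable def R0.mk {E : Type*} [CommRing E] [Algebra k E] {L : Type*} [CommRing L]
    [Algebra k L] (x : E ⊗[k] L) (h : x * x = 1) (hN : Algebra.norm E x = 1) : R0 k L E :=
  ⟨⟨⟨x, x, h, h⟩, by
    rw [mem_rootsOfUnity]
    ext
    rw [sq]
    exact h⟩, by
    rw [MonoidHom.mem_ker]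
    ext
    exact hN⟩

lemma R0.ext_val {E : Type*} [CommRing E] [Algebra k E] {L : Type*} [CommRing L] [Algebra k L]
    {x y : R0 k L E} (h : (x.1.1 : E ⊗[k] L) = y.1.1) : x = y :=
  Subtype.ext (Subtype.ext (Units.ext h))

/-- The fiber over a separable form of nonzero leading coefficient which splits over `K`. -/
structure IsSplitForm (f : Fin (n + 1) → k) (K : Type*) [Field K] [Algebra k K] : Prop where
  lead_ne_zero : f 0 ≠ 0
  exists_roots : ∃ r : Fin n → K, IsRootSystem f r

lemma IsSplitForm.isUnit_det_A (hf : IsSplitForm f K) (v : fiber f K) : IsUnit v.1.A.det :=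
  PairsOfForms.isUnit_det_A v.2 hf.lead_ne_zero

variable {E : Type*} [CommRing E] [Algebra k E]

lemma IsSplitForm.T_map (hf : IsSplitForm f K) (v : fiber f K) (φ : K →ₐ[k] E) :
    (v.1.map φ).T = v.1.T.map φ :=
  SymPair.T_map (φ : K →+* E) (hf.isUnit_det_A v)

lemma IsSplitForm.aeval_T_map (hf : IsSplitForm f K) (v : fiber f K) (φ : K →ₐ[k] E) :
    aeval (v.1.T.map φ) (monicPoly f) = 0 := by
  rw [← hf.T_map]
  exact aeval_T_of_mem_fiber (map_mem_fiber φ v.2) hf.lead_ne_zero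

/-- The map `p(β) ↦ p(T)` on `E ⊗ L`. -/
noncomputable def evalT (hf : IsSplitForm f K) (v : fiber f K) (φ : K →ₐ[k] E) :
    E ⊗[k] AlgL f →ₐ[E] Matrix (Fin n) (Fin n) E :=
  evalAt (v.1.T.map φ) (hf.aeval_T_map v φ)

lemma evalT_evalBeta (hf : IsSplitForm f K) (v : fiber f K) (φ : K →ₐ[k] E) (p : E[X]) :
    evalT hf v φ (evalBeta f p) = aeval (v.1.map φ).T p := by
  rw [evalT, evalAt_evalBeta, hf.T_map]

lemma exists_diagonalization_T (hf : IsSplitForm f K) (v : fiber f K) {r : Fin n → K}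
    (hr : IsRootSystem f r) : ∃ P Q, IsDiagonalization v.1.T r P Q :=
  exists_isDiagonalization hr (charpoly_T_of_mem_fiber v.2 hf.lead_ne_zero)

lemma det_evalT (hf : IsSplitForm f K) (v : fiber f K) (φ : K →ₐ[k] E) (x : E ⊗[k] AlgL f) :
    (evalT hf v φ x).det = Algebra.norm E x := by
  obtain ⟨r, hr⟩ := hf.exists_roots
  obtain ⟨P, Q, h⟩ := exists_diagonalization_T hf v hr
  exact h.det_evalAt hr φ _ x

lemma evalT_injective (hf : IsSplitForm f K) (v : fiber f K) (φ : K →ₐ[k] E) :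
    Function.Injective (evalT hf v φ) := by
  obtain ⟨r, hr⟩ := hf.exists_roots
  obtain ⟨P, Q, h⟩ := exists_diagonalization_T hf v hr
  exact h.evalAt_injective hr φ _

lemma exists_evalT_eq (hf : IsSplitForm f K) (v : fiber f K) (φ : K →ₐ[k] E)
    {N : Matrix (Fin n) (Fin n) E} (hN : N * (v.1.map φ).T = (v.1.map φ).T * N) :
    ∃ x, evalT hf v φ x = N := by
  obtain ⟨r, hr⟩ := hf.exists_roots
  obtain ⟨P, Q, h⟩ := exists_diagonalization_T hf v hr
  rw [hf.T_map] at hN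
  exact h.exists_evalAt_eq hr φ _ hN

lemma transpose_evalT_mul (hf : IsSplitForm f K) (v : fiber f K) (φ : K →ₐ[k] E)
    (x : E ⊗[k] AlgL f) :
    (evalT hf v φ x).transpose * (v.1.map φ).A = (v.1.map φ).A * evalT hf v φ x := by
  obtain ⟨p, rfl⟩ := evalBeta_surjective x
  rw [evalT_evalBeta]
  exact transpose_aeval_mul (SymPair.transpose_T_mul_A
    (isUnit_det_A (map_mem_fiber φ v.2) hf.lead_ne_zero)) p

lemma evalT_mul_T (hf : IsSplitForm f K) (v : fiber f K) (φ : K →ₐ[k] E) (x : E ⊗[k] AlgL f) :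
    evalT hf v φ x * (v.1.map φ).T = (v.1.map φ).T * evalT hf v φ x := by
  obtain ⟨p, rfl⟩ := evalBeta_surjective x
  have h := evalT_evalBeta hf v φ X
  rw [aeval_X] at h
  rw [← h, ← map_mul, ← map_mul, mul_comm]

/-- The homomorphism `p(β) ↦ p(T)` from `(Res μ₂)_{N = 1}` to `SL_n`. -/
noncomputable def R0.toSL (hf : IsSplitForm f K) (v : fiber f K) (φ : K →ₐ[k] E) :
    R0 k (AlgL f) E →* SL n E where
  toFun x := ⟨evalT hf v φ (x.1.1 : E ⊗[k] AlgL f), by rw [det_evalT, norm_eq_one]⟩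
  map_one' := by
    apply Subtype.ext
    exact map_one (evalT hf v φ)
  map_mul' x y := by
    apply Subtype.ext
    exact map_mul (evalT hf v φ) _ _

lemma R0.coe_toSL (hf : IsSplitForm f K) (v : fiber f K) (φ : K →ₐ[k] E)
    (x : R0 k (AlgL f) E) :
    (R0.toSL hf v φ x : Matrix (Fin n) (Fin n) E) = evalT hf v φ (x.1.1 : E ⊗[k] AlgL f) := rfl

/-- With `X = x(T)` self-adjoint and `X² = 1`, `XᵗAX = AX² = A`. Since `X` commutes with `T`, the
same holds for `B = AT`. -/
lemma R0.toSL_smul (hf : IsSplitForm f K) (v : fiber f K) (φ : K →ₐ[k] E)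
    (x : R0 k (AlgL f) E) : R0.toSL hf v φ x • v.1.map φ = v.1.map φ := by
  have h : evalT hf v φ (x.1.1 : E ⊗[k] AlgL f) * evalT hf v φ (x.1.1 : E ⊗[k] AlgL f) = 1 := by
    rw [← map_mul, val_sq_eq_one, map_one]
  have hA := isUnit_det_A (map_mem_fiber φ v.2) hf.lead_ne_zero
  rw [SymPair.smul_eq_iff, R0.coe_toSL, transpose_evalT_mul, mul_assoc, h, mul_one]
  refine ⟨rfl, ?_⟩
  rw [← SymPair.A_mul_T hA, ← mul_assoc, transpose_evalT_mul, mul_assoc, mul_assoc, ← evalT_mul_T,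
    ← mul_assoc (evalT hf v φ _), h, one_mul]

lemma R0.toSL_injective (hf : IsSplitForm f K) (v : fiber f K) (φ : K →ₐ[k] E) :
    Function.Injective (R0.toSL hf v φ) := fun _ _ h =>
  R0.ext_val (evalT_injective hf v φ (congrArg Subtype.val h))

/-- An element fixing `A` and `B` commutes with `T`, hence is `x(T)` for some `x`. Invariance of `A`
and self-adjointness give `A x(T)² = A`, so `x² = 1`; the determinant gives norm one. -/
lemma R0.exists_toSL_eq (hf : IsSplitForm f K) (v : fiber f K) (φ : K →ₐ[k] E) {g : SL n E}
    (hg : g • v.1.map φ = v.1.map φ) : ∃ x, R0.toSL hf v φ x = g := by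
  obtain ⟨h1, h2⟩ := (SymPair.smul_eq_iff _ _ _).1 hg
  have hA := isUnit_det_A (map_mem_fiber φ v.2) hf.lead_ne_zero
  have hA' := (Matrix.isUnit_iff_isUnit_det _).2 hA
  set M : Matrix (Fin n) (Fin n) E := (g : Matrix (Fin n) (Fin n) E)
  set A := (v.1.map φ).A
  set T := (v.1.map φ).T
  have hT : A * T = (v.1.map φ).B := SymPair.A_mul_T hA
  have hM' : ((g⁻¹ : SL n E) : Matrix (Fin n) (Fin n) E) * M = 1 := coe_inv_mul_coe g
  have hM'' : M * ((g⁻¹ : SL n E) : Matrix (Fin n) (Fin n) E) = 1 := coe_mul_coe_inv g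
  have h3 : A * ((g⁻¹ : SL n E) : Matrix (Fin n) (Fin n) E) = M.transpose * A := by
    rw [h1, mul_assoc, hM'', mul_one, ← h1]
  have hc : M * T = T * M := by
    rw [← hT, ← mul_assoc, ← h3, mul_assoc, mul_assoc] at h2
    have h4 := hA'.mul_right_inj.1 h2
    have h5 := congrArg (fun N => M * N) h4
    simpa only [← mul_assoc, hM'', one_mul] using h5
  obtain ⟨x, hx⟩ := exists_evalT_eq hf v φ hc
  have hxx : x * x = 1 := by
    apply evalT_injective hf v φ
    rw [map_mul, map_one, hx]
    apply hA'.mul_right_inj.1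
    rw [← mul_assoc, mul_one]
    have := transpose_evalT_mul hf v φ x
    rw [hx] at this
    rw [← this]
    exact h1.symm
  have hN : Algebra.norm E x = 1 := by
    rw [← det_evalT hf v φ, hx]
    exact g.2
  exact ⟨R0.mk x hxx hN, Subtype.ext hx⟩

/-- The isomorphism `p(β) ↦ p(T)` from `(Res μ₂)_{N = 1}` to the stabilizer in `SL_n`. -/
noncomputable def stabEquivSL (hf : IsSplitForm f K) (v : fiber f K) (φ : K →ₐ[k] E) :
    R0 k (AlgL f) E ≃* MulAction.stabilizer (SL n E) (v.1.map φ) :=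
  MulEquiv.ofBijective ((R0.toSL hf v φ).codRestrict _ (R0.toSL_smul hf v φ))
    ⟨fun _ _ h => R0.toSL_injective hf v φ (congrArg Subtype.val h), fun g => by
      obtain ⟨x, hx⟩ := R0.exists_toSL_eq hf v φ g.2
      exact ⟨x, Subtype.ext hx⟩⟩

/-- The two copies of `μ₂` correspond, so the isomorphism for `SL_n` descends to the quotients and
stays injective there. -/
lemma R0.toSL_mem_scalarMu2_iff (hf : IsSplitForm f K) (v : fiber f K) (φ : K →ₐ[k] E)
    (x : R0 k (AlgL f) E) : R0.toSL hf v φ x ∈ scalarMu2 n E ↔ x ∈ diagMu2 k (AlgL f) E := by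
  refine exists_congr fun c => and_congr_right fun _ => ?_
  have h : evalT hf v φ (c ⊗ₜ[k] (1 : AlgL f)) = c • (1 : Matrix (Fin n) (Fin n) E) := by
    have : c ⊗ₜ[k] (1 : AlgL f) = algebraMap E _ c := rfl
    rw [this, AlgHom.commutes, Algebra.algebraMap_eq_smul_one]
  rw [R0.coe_toSL, ← h, (evalT_injective hf v φ).eq_iff]

/-- The homomorphism `(Res μ₂)_{N = 1} / μ₂ → SL_n / μ₂`. -/
noncomputable def R0modMu2.toSLmodMu2 (hf : IsSplitForm f K) (v : fiber f K) (φ : K →ₐ[k] E) :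
    R0modMu2 k (AlgL f) E →* SLmodMu2 n E :=
  QuotientGroup.map _ _ (R0.toSL hf v φ) fun x hx => (R0.toSL_mem_scalarMu2_iff hf v φ x).2 hx

lemma R0modMu2.toSLmodMu2_injective (hf : IsSplitForm f K) (v : fiber f K) (φ : K →ₐ[k] E) :
    Function.Injective (R0modMu2.toSLmodMu2 hf v φ) := by
  rw [injective_iff_map_eq_one]
  intro x hx
  obtain ⟨x, rfl⟩ := QuotientGroup.mk_surjective x
  exact (QuotientGroup.eq_one_iff _).2
    ((R0.toSL_mem_scalarMu2_iff hf v φ x).1 ((QuotientGroup.eq_one_iff _).1 hx))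

/-- The isomorphism from `(Res μ₂)_{N = 1} / μ₂` to the stabilizer in `SL_n / μ₂`. -/
noncomputable def stabEquivSLmodMu2 (hf : IsSplitForm f K) (v : fiber f K) (φ : K →ₐ[k] E) :
    R0modMu2 k (AlgL f) E ≃* MulAction.stabilizer (SLmodMu2 n E) (v.1.map φ) :=
  MulEquiv.ofBijective ((R0modMu2.toSLmodMu2 hf v φ).codRestrict _ (by
      intro x
      obtain ⟨x, rfl⟩ := QuotientGroup.mk_surjective x
      exact R0.toSL_smul hf v φ x))
    ⟨fun _ _ h => R0modMu2.toSLmodMu2_injective hf v φ (congrArg Subtype.val h), by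
      rintro ⟨g, hg⟩
      obtain ⟨g, rfl⟩ := QuotientGroup.mk_surjective g
      obtain ⟨x, rfl⟩ := R0.exists_toSL_eq hf v φ hg
      exact ⟨QuotientGroup.mk x, rfl⟩⟩

/-! ### Functoriality in `E` and behaviour under conjugation. -/

lemma aeval_map_matrix {E' : Type*} [CommRing E'] (ψ : E →+* E') (M : Matrix (Fin n) (Fin n) E)
    (p : E[X]) : aeval (M.map ψ) (p.map ψ) = (aeval M p).map ψ := by
  have h : (algebraMap E' (Matrix (Fin n) (Fin n) E')).comp ψ =
      (ψ.mapMatrix).comp (algebraMap E (Matrix (Fin n) (Fin n) E)) := by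
    ext1 e
    exact (Matrix.algebraMap_eq_diagonal _).trans (by
      simp [Matrix.algebraMap_eq_diagonal, Matrix.diagonal_map])
  exact (map_aeval_eq_aeval_map (R := E) (S := Matrix (Fin n) (Fin n) E) h p M).symm

lemma baseMap_evalBeta {E' : Type*} [CommRing E'] [Algebra k E'] (ψ : E →ₐ[k] E') (p : E[X]) :
    baseMap k (AlgL f) ψ (evalBeta f p) = evalBeta f (p.map (ψ : E →+* E')) := by
  have h : (algebraMap E' (E' ⊗[k] AlgL f)).comp (ψ : E →+* E') =
      (baseMap k (AlgL f) ψ : E ⊗[k] AlgL f →+* E' ⊗[k] AlgL f).comp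
        (algebraMap E (E ⊗[k] AlgL f)) := by
    ext1 e
    simp [Algebra.TensorProduct.algebraMap_apply]
  have := map_aeval_eq_aeval_map h p ((1 : E) ⊗ₜ[k] AdjoinRoot.root (monicPoly f))
  refine this.trans ?_
  rw [evalBeta]
  congr 2
  simp

/-- Functoriality of evaluation in matrices. -/
lemma map_evalAt {E' : Type*} [CommRing E'] [Algebra k E'] (ψ : E →ₐ[k] E')
    {M : Matrix (Fin n) (Fin n) E} (hM : aeval M (monicPoly f) = 0)
    {M' : Matrix (Fin n) (Fin n) E'} (hM' : aeval M' (monicPoly f) = 0) (h : M.map ψ = M')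
    (x : E ⊗[k] AlgL f) :
    evalAt (E := E') M' hM' (baseMap k (AlgL f) ψ x) = (evalAt (E := E) M hM x).map ψ := by
  subst h
  obtain ⟨p, rfl⟩ := evalBeta_surjective x
  rw [baseMap_evalBeta, evalAt_evalBeta, evalAt_evalBeta]
  exact aeval_map_matrix (ψ : E →+* E') M p

/-- Two points are allowed so that one statement covers both uses: `v' = v`, `φ' = ψ ∘ φ` is
naturality in `E`, and `v = σ⁻¹v'` over `K` is Galois equivariance. -/
lemma R0.toSL_map {E' : Type*} [CommRing E'] [Algebra k E'] (hf : IsSplitForm f K)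
    {v v' : fiber f K} {φ : K →ₐ[k] E} {φ' : K →ₐ[k] E'} (ψ : E →ₐ[k] E')
    (h : (v.1.map φ).map ψ = v'.1.map φ') (x : R0 k (AlgL f) E) :
    R0.toSL hf v' φ' (R0.map ψ x) = Matrix.SpecialLinearGroup.map (ψ : E →+* E')
      (R0.toSL hf v φ x) := by
  apply Subtype.ext
  refine map_evalAt ψ _ _ ?_ _
  rw [← hf.T_map, ← hf.T_map, ← h]
  exact (SymPair.T_map (ψ : E →+* E')
    (isUnit_det_A (map_mem_fiber φ v.2) hf.lead_ne_zero)).symm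

lemma R0.toSL_conj (hf : IsSplitForm f K) (g : SL n K) (v : fiber f K) (x : R0 k (AlgL f) K) :
    R0.toSL hf (g • v) (AlgHom.id k K) x = g * R0.toSL hf v (AlgHom.id k K) x * g⁻¹ := by
  obtain ⟨p, hp⟩ := evalBeta_surjective (x.1.1 : K ⊗[k] AlgL f)
  rw [eq_mul_inv_iff_mul_eq]
  apply Subtype.ext
  rw [Matrix.SpecialLinearGroup.coe_mul, Matrix.SpecialLinearGroup.coe_mul, R0.coe_toSL,
    R0.coe_toSL, ← hp, evalT_evalBeta, evalT_evalBeta]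
  apply aeval_mul_eq_mul_aeval
  change (g • v.1).T * _ = _ * v.1.T
  rw [SymPair.T_smul g (hf.isUnit_det_A v), mul_assoc, coe_inv_mul_coe, mul_one]

end Stabilizers

/-! ### Uniqueness and functoriality of obstruction classes -/

section ObstructionClasses

variable {Γ : Type*} [Group Γ] {G X : Type*} [Group G] [MulAction G X] [MulDistribMulAction Γ G]
  [MulAction Γ X] [SMulDistribClass Γ G X]

/-- `G` acts transitively on `X` with stabilizers that descend. -/
structure HasDescent (G X : Type*) [Group G] [MulAction G X] : Prop where
  exists_smul_eq : ∀ x y : X, ∃ g : G, g • x = y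
  exists_desc : ∀ (x : X) (g : G), g • x = x → ∃ b : DescStab G X, b.1 x = g

/-- By transitivity a descended family is determined by its value at one point. -/
lemma HasDescent.ext (h : HasDescent G X) {b b' : DescStab G X} {x : X} (hb : b.1 x = b'.1 x) :
    b = b' := by
  ext y
  obtain ⟨g, rfl⟩ := h.exists_smul_eq x y
  rw [b.2.2, b'.2.2, hb]

/-- The Galois action seen at the single point `x`: it is twisted by the element bringing `σ x` back
to `x`. -/
lemma DescStab.smul_apply_of_smul_eq (b : DescStab G X) {σ : Γ} {x : X} {g : G}
    (hg : g • σ • x = x) : (σ • b).1 x = g * σ • b.1 x * g⁻¹ := by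
  have h := (σ • b).2.2 g (σ • x)
  rw [hg] at h
  rw [h]
  change g * σ • b.1 (σ⁻¹ • σ • x) * g⁻¹ = _
  rw [inv_smul_smul]

variable [TopologicalSpace Γ]

/-- If `y = a x`, then `a⁻¹ g'_σ σ(a)` is another admissible choice at `x`. Its quotient by `g_σ`
stabilizes `x`, and the resulting cochain `b` has coboundary `c⁻¹c'`. -/
lemma HasDescent.class_unique (h : HasDescent G X)
    (hG : ∀ g : G, IsLocallyConstant fun σ : Γ => σ • g) {d d' : H2 Γ (DescStab G X)}
    (hd : IsObstructionClass d) (hd' : IsObstructionClass d') : d = d' := by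
  obtain ⟨x, g, c, hg, hgx, hc, rfl⟩ := hd
  obtain ⟨y, g', c', hg', hgy, hc', rfl⟩ := hd'
  obtain ⟨a, rfl⟩ := h.exists_smul_eq x y
  have hga : ∀ σ, (a⁻¹ * g' σ * σ • a) • σ • x = x := fun σ => by
    rw [mul_smul, mul_smul, ← smul_distrib_smul, hgy, inv_smul_smul]
  have hb : ∀ σ, ∃ b : DescStab G X, b.1 x = a⁻¹ * g' σ * σ • a * (g σ)⁻¹ := fun σ => by
    apply h.exists_desc
    have : (g σ)⁻¹ • x = σ • x := by rw [inv_smul_eq_iff, hgx]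
    rw [mul_smul, this, hga]
  choose b hb using hb
  rw [QuotientGroup.eq]
  refine ⟨b, ?_, fun σ τ => ?_⟩
  · rw [IsLocallyConstant.iff_eventually_eq]
    intro σ
    filter_upwards [(IsLocallyConstant.iff_eventually_eq _).1 hg σ,
      (IsLocallyConstant.iff_eventually_eq _).1 hg' σ,
      (IsLocallyConstant.iff_eventually_eq _).1 (hG a) σ] with τ e1 e2 e3
    apply h.ext (x := x)
    simp only [hb, e1, e2, e3]
  · have hcc : c.1 (σ, τ) * (b σ * σ • b τ) = c'.1 (σ, τ) * b (σ * τ) := by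
      -- The descended group is commutative; with `c` moved to the right, adjacent factors of the
      -- values at `x` cancel.
      rw [mul_comm]
      apply h.ext (x := x)
      have h1 : (c'.1 (σ, τ)).1 x = a⁻¹ * (g' σ * σ • g' τ * (g' (σ * τ))⁻¹) * a := by
        rw [← hc', (c'.1 (σ, τ)).2.2]
        group
      simp only [Subgroup.coe_mul, Pi.mul_apply, h1, hc,
        DescStab.smul_apply_of_smul_eq _ (hgx σ), hb, smul_mul', smul_inv', mul_smul, mul_assoc,
        inv_mul_cancel_left, mul_inv_cancel_left]
    change σ • b τ / b (σ * τ) * b σ = (c.1 (σ, τ))⁻¹ * c'.1 (σ, τ)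
    rw [eq_inv_mul_iff_mul_eq, div_eq_mul_inv, mul_right_comm, ← mul_assoc, mul_inv_eq_iff_eq_mul,
      mul_comm (σ • b τ), hcc]

variable {H : Type*} [Group H] [MulAction H X] [MulDistribMulAction Γ H] [SMulDistribClass Γ H X]

lemma IsObstructionClass.map (p : G →* H) (hp : Function.Surjective p)
    (hX : ∀ (g : G) (x : X), p g • x = g • x) (hΓ : ∀ (σ : Γ) (g : G), p (σ • g) = σ • p g)
    {d : H2 Γ (DescStab G X)} (hd : IsObstructionClass d) :
    IsObstructionClass (H2.map (DescStab.map p hp hX) (DescStab.map_smul p hp hX hΓ) d) := by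
  obtain ⟨x, g, c, hg, hgx, hc, rfl⟩ := hd
  refine ⟨x, p ∘ g, Z2.map _ (DescStab.map_smul p hp hX hΓ) c, hg.comp p, fun σ => ?_,
    fun σ τ => ?_, rfl⟩
  · rw [Function.comp_apply, hX, hgx]
  · change p ((c.1 (σ, τ)).1 x) = _
    rw [hc, map_mul, map_mul, hΓ, map_inv]
    rfl

end ObstructionClasses

/-! ### Transitivity over a separably closed field -/

section Transitivity

open Polynomial

variable {k : Type*} [Field k] {n : ℕ} {f : Fin (n + 1) → k}

/-- The resultant of `p` and `p'` is a combination of the two, and equals the discriminant up to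
sign and leading coefficient, so it is a unit. -/
lemma separable_of_discr_ne_zero {p : k[X]} (hp : 0 < p.natDegree) (h : p.discr ≠ 0) :
    p.Separable := by
  have hd : 0 < p.degree := natDegree_pos_iff_degree_pos.1 hp
  obtain ⟨a, b, -, -, hab⟩ := exists_mul_add_mul_eq_C_resultant p (derivative p) le_rfl
    (natDegree_derivative_le p) (Or.inl hp.ne')
  have hu : IsUnit (C (resultant p (derivative p) p.natDegree (p.natDegree - 1))) := by
    rw [isUnit_C, resultant_deriv hd, isUnit_iff_ne_zero]
    refine mul_ne_zero (mul_ne_zero (pow_ne_zero _ (neg_ne_zero.2 one_ne_zero)) ?_) h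
    exact leadingCoeff_ne_zero.2 (ne_zero_of_natDegree_gt hp)
  obtain ⟨u, hu⟩ := hu
  refine ⟨(↑u⁻¹ : k[X]) * a, (↑u⁻¹ : k[X]) * b, ?_⟩
  rw [mul_assoc, mul_assoc, ← mul_add, mul_comm a, mul_comm b, hab, ← hu, Units.inv_mul]

variable {K : Type*} [Field K] [Algebra k K]

lemma isSplitForm_of_discr_ne_zero [IsSepClosed K] (hn : 0 < n) (hf0 : f 0 ≠ 0)
    (hΔ : (dehomogenization f).discr ≠ 0) : IsSplitForm f K := by
  refine ⟨hf0, ?_⟩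
  have hd : (dehomogenization f).natDegree = n := by
    rw [dehomogenization_eq f hf0, natDegree_C_mul hf0, monicPoly_natDegree]
  have hs := separable_of_discr_ne_zero (by rw [hd]; exact hn) hΔ
  rw [dehomogenization_eq f hf0] at hs
  have hs : (monicPoly f).Separable := hs.of_mul_right
  have hs' : ((monicPoly f).map (algebraMap k K)).Separable := hs.map
  have hsp := IsSepClosed.splits_of_separable _ hs'
  have hcard : Multiset.card ((monicPoly f).map (algebraMap k K)).roots = n := by
    rw [← hsp.natDegree_eq_card_roots, natDegree_map, monicPoly_natDegree]
  classical
  have hcard' : ((monicPoly f).map (algebraMap k K)).roots.toFinset.card = n := by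
    rw [Multiset.toFinset_card_of_nodup (nodup_roots hs'), hcard]
  let e := Finset.equivFinOfCardEq hcard'
  refine ⟨fun i => (e.symm i : K), Subtype.val_injective.comp e.symm.injective, fun i => ?_⟩
  have := Multiset.mem_toFinset.1 (e.symm i).2
  rw [mem_roots', IsRoot.def, eval_map_algebraMap] at this
  exact this.2

/-- A basis of `Kⁿ` in which `A` is the identity and `B` is diagonal. -/
lemma exists_orthonormal [IsSepClosed K] (h2 : (2 : K) ≠ 0) (hf : IsSplitForm f K)
    {r : Fin n → K} (hr : IsRootSystem f r) (v : fiber f K) :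
    ∃ P Q : Matrix (Fin n) (Fin n) K, P * Q = 1 ∧ Q * P = 1 ∧
      P.transpose * v.1.A * P = 1 ∧ P.transpose * v.1.B * P = Matrix.diagonal r := by
  obtain ⟨P, Q, h⟩ := exists_diagonalization_T hf v hr
  have hA := hf.isUnit_det_A v
  have hT := SymPair.transpose_T_mul_A hA
  -- Self-adjointness of `T` read in the eigenbasis. As the eigenvalues are distinct, the Gram
  -- matrix of `A` there is diagonal: eigenvectors are orthogonal.
  have hc : P.transpose * v.1.A * P * Matrix.diagonal r =
      Matrix.diagonal r * (P.transpose * v.1.A * P) := by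
    rw [mul_assoc, ← h.mul_eq, ← mul_assoc, mul_assoc P.transpose, ← hT, ← mul_assoc P.transpose,
      ← Matrix.transpose_mul, h.mul_eq, Matrix.transpose_mul, Matrix.diagonal_transpose]
    simp only [mul_assoc]
  have hD := eq_diagonal_of_commute
    (fun i j hij => IsUnit.mk0 _ (sub_ne_zero.2 (hr.injective.ne hij))) hc
  set a : Fin n → K := fun i => (P.transpose * v.1.A * P) i i with ha
  have ha0 : ∀ i, a i ≠ 0 := by
    have hP : IsUnit P.det := IsUnit.of_mul_eq_one Q.det (by
      rw [← Matrix.det_mul, h.mul_inv, Matrix.det_one])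
    have : IsUnit (Matrix.diagonal a).det := by
      rw [← hD, Matrix.det_mul, Matrix.det_mul, Matrix.det_transpose]
      exact (hP.mul hA).mul hP
    rw [Matrix.det_diagonal, isUnit_iff_ne_zero, Finset.prod_ne_zero_iff] at this
    exact fun i => this i (Finset.mem_univ i)
  have : NeZero ((2 : ℕ) : K) := ⟨by rwa [Nat.cast_ofNat]⟩
  -- The eigenvectors are normalized by dividing by square roots of their lengths; rescaling does
  -- not affect the eigenvalues.
  choose c hc2 using fun i => IsSepClosed.exists_pow_nat_eq (a i) 2
  have hc0 : ∀ i, c i ≠ 0 := fun i hi => ha0 i (by rw [← hc2, hi, zero_pow two_ne_zero])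
  have h1 : Matrix.diagonal c⁻¹ * Matrix.diagonal c = 1 := by
    rw [Matrix.diagonal_mul_diagonal, ← Matrix.diagonal_one]
    congr 1
    ext i
    exact inv_mul_cancel₀ (hc0 i)
  have h1' : Matrix.diagonal c * Matrix.diagonal c⁻¹ = 1 := by
    rw [Matrix.diagonal_mul_diagonal, ← Matrix.diagonal_one]
    congr 1
    ext i
    exact mul_inv_cancel₀ (hc0 i)
  have hAP : (P * Matrix.diagonal c⁻¹).transpose * v.1.A * (P * Matrix.diagonal c⁻¹) = 1 := by
    have : (P * Matrix.diagonal c⁻¹).transpose * v.1.A * (P * Matrix.diagonal c⁻¹) =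
        Matrix.diagonal c⁻¹ * (P.transpose * v.1.A * P) * Matrix.diagonal c⁻¹ := by
      rw [Matrix.transpose_mul, Matrix.diagonal_transpose]
      simp only [mul_assoc]
    rw [this, hD, Matrix.diagonal_mul_diagonal, Matrix.diagonal_mul_diagonal,
      ← Matrix.diagonal_one]
    congr 1
    ext i
    have := hc0 i
    rw [← hc2]
    simp only [Pi.inv_apply]
    field_simp
  refine ⟨P * Matrix.diagonal c⁻¹, Matrix.diagonal c * Q, ?_, ?_, hAP, ?_⟩
  · rw [mul_assoc, ← mul_assoc _ _ Q, h1, one_mul, h.mul_inv]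
  · rw [mul_assoc, ← mul_assoc Q, h.inv_mul, one_mul, h1']
  · have hTP : v.1.T * (P * Matrix.diagonal c⁻¹) = P * Matrix.diagonal c⁻¹ * Matrix.diagonal r := by
      rw [← mul_assoc, h.mul_eq, mul_assoc, mul_assoc, Matrix.diagonal_mul_diagonal,
        Matrix.diagonal_mul_diagonal]
      simp only [mul_comm]
    rw [← SymPair.A_mul_T hA, mul_assoc, mul_assoc, hTP, ← mul_assoc, ← mul_assoc, hAP, one_mul]

lemma exists_smul_eq_of_orthonormal {M N : SymPair n K} {P Q P' D : Matrix (Fin n) (Fin n) K}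
    (hQP : Q * P = 1) (hdet : P.det = P'.det)
    (hA : P.transpose * M.A * P = 1) (hB : P.transpose * M.B * P = D)
    (hA' : P'.transpose * N.A * P' = 1) (hB' : P'.transpose * N.B * P' = D) :
    ∃ g : SL n K, g • M = N := by
  have hd : (P' * Q).det = 1 := by
    rw [Matrix.det_mul, ← hdet, ← Matrix.det_mul, mul_eq_one_comm.1 hQP, Matrix.det_one]
  have key : ∀ R S C : Matrix (Fin n) (Fin n) K, P.transpose * R * P = C →
      P'.transpose * S * P' = C → R = (P' * Q).transpose * S * (P' * Q) := by
    intro R S C h h'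
    rw [transpose_conj_eq_iff hQP (mul_eq_one_comm.1 hQP)] at h
    rw [h, ← h', Matrix.transpose_mul]
    simp only [mul_assoc]
  refine ⟨⟨P' * Q, hd⟩, (SymPair.smul_eq_iff _ _ _).2 ⟨key _ _ _ hA hA', key _ _ _ hB hB'⟩⟩

/-- Both pairs become `(1, diag r)` with the same numbering of the roots. The form `f` fixes `det
A`, and `det A · (det P)² = 1`, so the two changes of basis have equal determinants up to sign. -/
lemma fiber_exists_smul_eq [IsSepClosed K] (hn : 0 < n) (h2 : (2 : K) ≠ 0) (hf : IsSplitForm f K)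
    (v w : fiber f K) : ∃ g : SL n K, g • v = w := by
  obtain ⟨r, hr⟩ := hf.exists_roots
  obtain ⟨P, Q, -, hQP, hA, hB⟩ := exists_orthonormal h2 hf hr v
  obtain ⟨P', -, -, -, hA', hB'⟩ := exists_orthonormal h2 hf hr w
  have hdet : v.1.A.det = w.1.A.det := by
    have h := (det_A_of_mem_fiber v.2).trans (det_A_of_mem_fiber w.2).symm
    exact mul_left_cancel₀ (pow_ne_zero _ (neg_ne_zero.2 one_ne_zero)) h
  have hP := congrArg Matrix.det hA
  have hP' := congrArg Matrix.det hA'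
  rw [Matrix.det_mul, Matrix.det_mul, Matrix.det_transpose, Matrix.det_one] at hP hP'
  have hsq : P.det = P'.det ∨ P.det = -P'.det := by
    apply sq_eq_sq_iff_eq_or_eq_neg.1
    apply mul_left_cancel₀ (hf.isUnit_det_A v).ne_zero
    rw [show v.1.A.det * P.det ^ 2 = P.det * v.1.A.det * P.det by ring, hP, hdet, ← hP']
    ring
  obtain ⟨g, hg⟩ : ∃ g : SL n K, g • v.1 = w.1 := by
    rcases hsq with h | h
    · exact exists_smul_eq_of_orthonormal hQP h hA hB hA' hB'
    -- Negating one vector of the second basis changes the sign of its determinant and preserves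
    -- both diagonal Gram matrices.
    · let s : Fin n → K := Function.update 1 ⟨0, hn⟩ (-1)
      have hs : ∀ i, s i * s i = 1 := fun i => by
        by_cases hi : i = ⟨0, hn⟩
        · subst hi; simp [s]
        · simp [s, hi]
      have hsd : (Matrix.diagonal s).det = -1 := by
        rw [Matrix.det_diagonal, Finset.prod_update_of_mem (Finset.mem_univ _)]
        simp
      have key : ∀ R : Matrix (Fin n) (Fin n) K, ∀ d : Fin n → K,
          P'.transpose * R * P' = Matrix.diagonal d →
          (P' * Matrix.diagonal s).transpose * R * (P' * Matrix.diagonal s) =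
            Matrix.diagonal d := by
        intro R d h
        rw [Matrix.transpose_mul, Matrix.diagonal_transpose]
        have : Matrix.diagonal s * P'.transpose * R * (P' * Matrix.diagonal s) =
            Matrix.diagonal s * (P'.transpose * R * P') * Matrix.diagonal s := by
          simp only [mul_assoc]
        rw [this, h, Matrix.diagonal_mul_diagonal, Matrix.diagonal_mul_diagonal]
        congr 1
        ext i
        rw [mul_right_comm, hs, one_mul]
      refine exists_smul_eq_of_orthonormal hQP ?_ hA hB
        ((key _ 1 (hA'.trans Matrix.diagonal_one.symm)).trans Matrix.diagonal_one) (key _ _ hB')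
      rw [Matrix.det_mul, hsd, h, mul_neg_one]
  exact ⟨g, Subtype.ext hg⟩

end Transitivity

/-! ### A pair of forms over the base field -/

section BasePair

open Polynomial

variable {k : Type*} [Field k] {n : ℕ}

/-- The reversal inverts every pair. This is the source of the sign `(-1)^(n(n-1)/2)` in the
invariant form. -/
lemma sign_revPerm (n : ℕ) :
    Equiv.Perm.sign (Fin.revPerm : Equiv.Perm (Fin n)) = (-1) ^ (n * (n - 1) / 2) := by
  rw [Equiv.Perm.sign_eq_prod_prod_Ioi]
  have : ∀ j : Fin n, (∏ i ∈ Finset.Ioi j,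
      if (Fin.revPerm j : Fin n) < Fin.revPerm i then (1 : ℤˣ) else -1) =
        (-1) ^ (n - 1 - (j : ℕ)) := by
    intro j
    rw [← Fin.card_Ioi, ← Finset.prod_const]
    refine Finset.prod_congr rfl fun i hi => if_neg ?_
    rw [Finset.mem_Ioi] at hi
    simpa using hi.le
  simp only [this]
  rw [Finset.prod_pow_eq_pow_sum, Fin.sum_univ_eq_sum_range (fun j => n - 1 - j) n,
    Finset.sum_range_reflect (fun j => j), Finset.sum_range_id]

/-- The Gram matrix, in the basis of powers of `β`, of the form on `L` sending `(x, y)` to the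
coefficient of `β^(n-1)` in `x y`. -/
noncomputable def baseA (f : Fin (n + 1) → k) (hn : 0 < n) : Matrix (Fin n) (Fin n) k :=
  Matrix.of fun i j => (betaBasis f).repr (betaBasis f i * betaBasis f j) ⟨n - 1, by omega⟩

/-- The matrix of multiplication by `β` in the basis of powers of `β`. -/
noncomputable def baseT (f : Fin (n + 1) → k) : Matrix (Fin n) (Fin n) k :=
  Algebra.leftMulMatrix (betaBasis f) (AdjoinRoot.root (monicPoly f))

lemma baseA_isSymm (f : Fin (n + 1) → k) (hn : 0 < n) : (baseA f hn).IsSymm := by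
  ext i j
  simp [baseA, mul_comm]

/-- The product is the Gram matrix of "coefficient of `β^(n-1)` in `βxy`", which makes its symmetry
evident. -/
lemma baseA_mul_baseT_apply (f : Fin (n + 1) → k) (hn : 0 < n) (i j : Fin n) :
    (baseA f hn * baseT f) i j = (betaBasis f).repr
      (betaBasis f i * (AdjoinRoot.root (monicPoly f) * betaBasis f j)) ⟨n - 1, by omega⟩ := by
  have h := (betaBasis f).sum_repr (AdjoinRoot.root (monicPoly f) * betaBasis f j)
  conv_rhs => rw [← h]
  simp only [Finset.mul_sum, mul_smul_comm, map_sum, map_smul, Finsupp.finsetSum_apply,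
    Finsupp.smul_apply, smul_eq_mul]
  simp [Matrix.mul_apply, baseA, baseT, Algebra.leftMulMatrix_eq_repr_mul, mul_comm]

lemma baseA_mul_baseT_isSymm (f : Fin (n + 1) → k) (hn : 0 < n) :
    (baseA f hn * baseT f).IsSymm := by
  ext i j
  rw [Matrix.transpose_apply, baseA_mul_baseT_apply, baseA_mul_baseT_apply]
  congr 2
  ring

lemma baseT_charpoly (f : Fin (n + 1) → k) : (baseT f).charpoly = monicPoly f := by
  let pb := AdjoinRoot.powerBasis' (monicPoly_monic f)
  have h := charpoly_leftMulMatrix pb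
  have h1 : minpoly k pb.gen = monicPoly f := by
    rw [AdjoinRoot.powerBasis'_gen, AdjoinRoot.minpoly_root (monicPoly_monic f).ne_zero,
      (monicPoly_monic f).leadingCoeff, inv_one, C_1, mul_one]
  rw [h1] at h
  rw [← h]
  have h2 := Matrix.charpoly_reindex
    (finCongr ((AdjoinRoot.powerBasis'_dim (monicPoly_monic f)).trans (monicPoly_natDegree f)))
    (Algebra.leftMulMatrix pb.basis pb.gen)
  rw [← h2]
  congr 1
  ext i j
  rw [Matrix.reindex_apply, Matrix.submatrix_apply, baseT, Algebra.leftMulMatrix_eq_repr_mul,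
    Algebra.leftMulMatrix_eq_repr_mul, betaBasis, Module.Basis.reindex_apply,
    Module.Basis.repr_reindex_apply]
  rfl

/-- The entry at `(i, j)`, counted from zero, is the top coefficient of `β^(i+j)`: it is `0` for `i
+ j < n - 1` and `1` for `i + j = n - 1`. Reversing the columns gives a lower unitriangular matrix.
-/
lemma baseA_det (f : Fin (n + 1) → k) (hn : 0 < n) :
    (-1) ^ (n * (n - 1) / 2) * (baseA f hn).det = 1 := by
  have hpow : ∀ m : Fin n, (betaBasis f).repr (AdjoinRoot.root (monicPoly f) ^ (m : ℕ))
      ⟨n - 1, by omega⟩ = if (m : ℕ) = n - 1 then 1 else 0 := by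
    intro m
    rw [← betaBasis_apply, Module.Basis.repr_self, Finsupp.single_apply]
    simp only [Fin.ext_iff]
  have htri : ((baseA f hn).submatrix id (Fin.revPerm : Equiv.Perm (Fin n))).det = 1 := by
    rw [Matrix.det_of_isLowerTriangular]
    · apply Finset.prod_eq_one
      intro i _
      have := hpow ⟨n - 1, by omega⟩
      simp only [Matrix.submatrix_apply, baseA, Matrix.of_apply, betaBasis_apply, ← pow_add]
      rw [if_pos rfl] at this
      rw [← this]
      congr 3
      simp [Fin.val_rev]
      omega
    · intro i j hij
      have hij : (i : ℕ) < j := hij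
      have := hpow ⟨(i : ℕ) + (Fin.rev j : Fin n), by rw [Fin.val_rev]; omega⟩
      simp only [Matrix.submatrix_apply, baseA, Matrix.of_apply, betaBasis_apply, ← pow_add]
      rw [if_neg (by simp [Fin.val_rev]; omega)] at this
      exact this
  rw [Matrix.det_permute', sign_revPerm] at htri
  push_cast at htri
  exact htri

end BasePair

section Descent

open Polynomial

variable {k : Type*} [Field k] {n : ℕ} {f : Fin (n + 1) → k}
variable {K : Type*} [Field K] [Algebra k K]

/-! ### Discreteness of the Galois actions -/

lemma isLocallyConstant_of_forall {Y Z ι κ : Type*} [TopologicalSpace Y] [Finite ι] {F : Y → Z}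
    {G : ι → Y → κ} (hG : ∀ i, IsLocallyConstant (G i))
    (h : ∀ y z, (∀ i, G i y = G i z) → F y = F z) : IsLocallyConstant F := by
  rw [IsLocallyConstant.iff_eventually_eq]
  intro y
  have := Filter.eventually_all.2 fun i => (IsLocallyConstant.iff_eventually_eq _).1 (hG i) y
  filter_upwards [this] with z hz using h z y hz

lemma isLocallyConstant_smul_SL [Algebra.IsIntegral k K] (g : SL n K) :
    IsLocallyConstant fun σ : Gal(K/k) => σ • g :=
  isLocallyConstant_of_forall (ι := Fin n × Fin n)
    (fun i => isLocallyConstant_galois_smul (k := k) (g.1 i.1 i.2)) fun σ τ h => by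
      ext i j
      exact h (i, j)

lemma isLocallyConstant_smul_SLmodMu2 [Algebra.IsIntegral k K] (g : SLmodMu2 n K) :
    IsLocallyConstant fun σ : Gal(K/k) => σ • g := by
  obtain ⟨g, rfl⟩ := QuotientGroup.mk_surjective g
  exact (isLocallyConstant_smul_SL g).comp QuotientGroup.mk

lemma isLocallyConstant_baseMap [Algebra.IsIntegral k K] {L : Type*} [CommRing L] [Algebra k L]
    (x : K ⊗[k] L) : IsLocallyConstant fun σ : Gal(K/k) => baseMap k L (σ : K →ₐ[k] K) x := by
  induction x using TensorProduct.induction_on with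
  | zero =>
    simp only [map_zero]
    exact IsLocallyConstant.const 0
  | tmul a l => exact (isLocallyConstant_galois_smul (k := k) a).comp fun b => b ⊗ₜ[k] l
  | add x y hx hy =>
    simp only [map_add]
    exact hx.add hy

lemma isLocallyConstant_smul_ResMu2 [Algebra.IsIntegral k K] {L : Type*} [CommRing L] [Algebra k L]
    (x : ResMu2 k L K) : IsLocallyConstant fun σ : Gal(K/k) => σ • x := by
  rw [IsLocallyConstant.iff_eventually_eq]
  intro σ
  filter_upwards [(IsLocallyConstant.iff_eventually_eq _).1
    (isLocallyConstant_baseMap (x.1 : K ⊗[k] L)) σ] with τ hτ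
  ext
  exact hτ

/-! ### The descended stabilizers -/

/-- The family of isomorphisms `p(β) ↦ p(T)`. -/
noncomputable def R0.toDescStab (hf : IsSplitForm f K) :
    R0 k (AlgL f) K →* DescStab (SL n K) (fiber f K) where
  toFun x := ⟨fun v => R0.toSL hf v (AlgHom.id k K) x,
    fun v => Subtype.ext (R0.toSL_smul hf v (AlgHom.id k K) x), fun g v => R0.toSL_conj hf g v x⟩
  map_one' := by
    apply Subtype.ext
    funext v
    exact map_one _
  map_mul' x y := by
    apply Subtype.ext
    funext v
    exact map_mul _ x y

/-- The family of isomorphisms induced by `p(β) ↦ p(T)` on the quotients by `μ₂`. -/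
noncomputable def R0modMu2.toDescStab (hf : IsSplitForm f K) :
    R0modMu2 k (AlgL f) K →* DescStab (SLmodMu2 n K) (fiber f K) where
  toFun x := ⟨fun v => R0modMu2.toSLmodMu2 hf v (AlgHom.id k K) x, fun v => by
      obtain ⟨x, rfl⟩ := QuotientGroup.mk_surjective x
      exact Subtype.ext (R0.toSL_smul hf v (AlgHom.id k K) x), fun g v => by
      obtain ⟨x, rfl⟩ := QuotientGroup.mk_surjective x
      obtain ⟨g, rfl⟩ := QuotientGroup.mk_surjective g
      exact congrArg (QuotientGroup.mk (s := scalarMu2 n K)) (R0.toSL_conj hf g v x)⟩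
  map_one' := by
    apply Subtype.ext
    funext v
    exact map_one _
  map_mul' x y := by
    apply Subtype.ext
    funext v
    exact map_mul _ x y

lemma R0.toDescStab_smul (hf : IsSplitForm f K) (σ : Gal(K/k)) (x : R0 k (AlgL f) K) :
    R0.toDescStab hf (σ • x) = σ • R0.toDescStab hf x := by
  apply Subtype.ext
  funext v
  refine R0.toSL_map hf (v := σ⁻¹ • v) (v' := v) (φ := AlgHom.id k K) (φ' := AlgHom.id k K)
    (σ : K →ₐ[k] K) ?_ x
  exact congrArg Subtype.val (smul_inv_smul σ v)

lemma R0modMu2.toDescStab_smul (hf : IsSplitForm f K) (σ : Gal(K/k))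
    (x : R0modMu2 k (AlgL f) K) :
    R0modMu2.toDescStab hf (σ • x) = σ • R0modMu2.toDescStab hf x := by
  obtain ⟨x, rfl⟩ := QuotientGroup.mk_surjective x
  have h := R0.toDescStab_smul hf σ x
  apply Subtype.ext
  funext v
  exact congrArg (QuotientGroup.mk (s := scalarMu2 n K))
    (congrFun (congrArg Subtype.val h) v)

lemma hasDescent_SL [IsSepClosed K] (hn : 0 < n) (h2 : (2 : K) ≠ 0) (hf : IsSplitForm f K) :
    HasDescent (SL n K) (fiber f K) where
  exists_smul_eq := fiber_exists_smul_eq hn h2 hf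
  exists_desc v g hg := by
    obtain ⟨x, hx⟩ := R0.exists_toSL_eq hf v (AlgHom.id k K) (congrArg Subtype.val hg)
    exact ⟨R0.toDescStab hf x, hx⟩

lemma hasDescent_SLmodMu2 [IsSepClosed K] (hn : 0 < n) (h2 : (2 : K) ≠ 0) (hf : IsSplitForm f K) :
    HasDescent (SLmodMu2 n K) (fiber f K) where
  exists_smul_eq v w := by
    obtain ⟨g, hg⟩ := fiber_exists_smul_eq hn h2 hf v w
    exact ⟨QuotientGroup.mk g, hg⟩
  exists_desc v g hg := by
    obtain ⟨g, rfl⟩ := QuotientGroup.mk_surjective g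
    obtain ⟨x, hx⟩ := R0.exists_toSL_eq hf v (AlgHom.id k K) (congrArg Subtype.val hg)
    exact ⟨R0modMu2.toDescStab hf (QuotientGroup.mk x), congrArg QuotientGroup.mk hx⟩

/-- Evaluation at `v` reduces this to the stabilizer of `v`; without a point in the fiber the target
would be trivial. -/
lemma R0.toDescStab_bijective [IsSepClosed K] (hn : 0 < n) (h2 : (2 : K) ≠ 0) (hf : IsSplitForm f K)
    (v : fiber f K) : Function.Bijective (R0.toDescStab hf) := by
  refine ⟨fun x y h => ?_, fun b => ?_⟩
  · exact R0.toSL_injective hf v (AlgHom.id k K) (congrFun (congrArg Subtype.val h) v)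
  · obtain ⟨x, hx⟩ := R0.exists_toSL_eq hf v (AlgHom.id k K) (congrArg Subtype.val (b.2.1 v))
    exact ⟨x, (hasDescent_SL hn h2 hf).ext hx⟩

lemma R0modMu2.toDescStab_bijective [IsSepClosed K] (hn : 0 < n) (h2 : (2 : K) ≠ 0)
    (hf : IsSplitForm f K) (v : fiber f K) :
    Function.Bijective (R0modMu2.toDescStab hf) := by
  refine ⟨fun x y h => ?_, fun b => ?_⟩
  · exact R0modMu2.toSLmodMu2_injective hf v (AlgHom.id k K)
      (congrFun (congrArg Subtype.val h) v)
  · obtain ⟨g, hg⟩ := QuotientGroup.mk_surjective (b.1 v)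
    have hgv : (QuotientGroup.mk g : SLmodMu2 n K) • v = v := by rw [hg, b.2.1 v]
    obtain ⟨x, hx⟩ := R0.exists_toSL_eq hf v (AlgHom.id k K) (congrArg Subtype.val hgv)
    exact ⟨QuotientGroup.mk x, (hasDescent_SLmodMu2 hn h2 hf).ext (x := v)
      ((congrArg QuotientGroup.mk hx).trans hg)⟩

/-! ### The norm sequence -/

/-- A section of the norm `(K ⊗ L)ˣ → Kˣ`. -/
lemma exists_norm_section (hn : 0 < n) (hf : IsSplitForm f K) :
    ∃ s : Kˣ →* (K ⊗[k] AlgL f)ˣ, ∀ u, Algebra.norm K (s u : K ⊗[k] AlgL f) = u := by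
  obtain ⟨r, hr⟩ := hf.exists_roots
  let e := evalRootsEquiv hr (AlgHom.id k K)
  -- Under `K ⊗ L ≅ Kⁿ`, `u` is put in one coordinate and `1` in the others. Multiplicativity makes
  -- the section send square roots of one to square roots of one.
  refine ⟨Units.map ((e.symm : (Fin n → K) →* K ⊗[k] AlgL f).comp
    (MonoidHom.mulSingle (fun _ : Fin n => K) ⟨0, hn⟩)), fun u => ?_⟩
  have h : evalRoots hr (AlgHom.id k K) (e.symm (Pi.mulSingle ⟨0, hn⟩ (u : K))) =
    Pi.mulSingle ⟨0, hn⟩ (u : K) := e.apply_symm_apply _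
  rw [norm_eq_prod_evalRoots hr (AlgHom.id k K)]
  refine (Finset.prod_congr rfl fun i _ => congrFun h i).trans ?_
  exact Fintype.prod_pi_mulSingle' _ _

lemma isShortExact_norm [Algebra.IsIntegral k K] (hn : 0 < n) (hf : IsSplitForm f K) :
    IsShortExact Gal(K/k) (R0 k (AlgL f) K).subtype (normMu2 k (AlgL f) K) where
  map_smul_left _ _ := rfl
  map_smul_right σ b := normMu2_map (σ : K →ₐ[k] K) b
  injective := Subtype.val_injective
  exact b := ⟨fun h => ⟨⟨b, h⟩, rfl⟩, by
    rintro ⟨a, rfl⟩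
    exact a.2⟩
  surjective ζ := by
    obtain ⟨s, hs⟩ := exists_norm_section hn hf
    refine ⟨⟨s ζ.1, ?_⟩, ?_⟩
    · rw [mem_rootsOfUnity, ← map_pow, (mem_rootsOfUnity _ _).1 ζ.2, map_one]
    · ext
      exact hs ζ.1
  discrete := isLocallyConstant_smul_ResMu2

end Descent

section ObstructionClass

open Polynomial

variable {k : Type*} [Field k] {n : ℕ} {f : Fin (n + 1) → k}
variable {K : Type*} [Field K] [Algebra k K]

/-! ### A point of the fiber attached to an element of norm `√f₀` -/

variable (f K) in
/-- Multiplication by `β` over `K`, in the basis of powers of `β`. -/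
noncomputable def extT : Matrix (Fin n) (Fin n) K := (baseT f).map (algebraMap k K)

variable (f K) in
/-- The Gram matrix of the base form over `K`. -/
noncomputable def extA (hn : 0 < n) : Matrix (Fin n) (Fin n) K := (baseA f hn).map (algebraMap k K)

lemma extT_charpoly : (extT f K).charpoly = (monicPoly f).map (algebraMap k K) := by
  rw [extT, Matrix.charpoly_map, baseT_charpoly]

lemma aeval_extT : aeval (extT f K) (monicPoly f) = 0 := by
  have h := (extT f K).aeval_self_charpoly
  rwa [extT_charpoly, aeval_map_algebraMap] at h

lemma transpose_extT_mul (hn : 0 < n) : (extT f K).transpose * extA f K hn =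
    extA f K hn * extT f K := by
  have h := baseA_mul_baseT_isSymm f hn
  rw [Matrix.IsSymm, Matrix.transpose_mul, (baseA_isSymm f hn).eq] at h
  have := congrArg (fun N : Matrix (Fin n) (Fin n) k => N.map (algebraMap k K)) h
  simp only [Matrix.map_mul] at this
  exact this

variable (f K) in
/-- The regular representation of `K ⊗ L`. -/
noncomputable def regRep : K ⊗[k] AlgL f →ₐ[K] Matrix (Fin n) (Fin n) K :=
  evalAt (extT f K) aeval_extT

lemma transpose_regRep_mul (hn : 0 < n) (x : K ⊗[k] AlgL f) :
    (regRep f K x).transpose * extA f K hn = extA f K hn * regRep f K x := by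
  obtain ⟨p, rfl⟩ := evalBeta_surjective x
  rw [regRep, evalAt_evalBeta]
  exact transpose_aeval_mul (transpose_extT_mul hn) p

lemma extA_mul_regRep_isSymm (hn : 0 < n) (x : K ⊗[k] AlgL f) :
    (extA f K hn * regRep f K x).IsSymm := by
  have h : (extA f K hn).transpose = extA f K hn :=
    ((baseA_isSymm f hn).map (algebraMap k K) :)
  rw [Matrix.IsSymm, Matrix.transpose_mul, h]
  exact transpose_regRep_mul hn x

lemma det_regRep (hf : IsSplitForm f K) (x : K ⊗[k] AlgL f) :
    (regRep f K x).det = Algebra.norm K x := by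
  obtain ⟨r, hr⟩ := hf.exists_roots
  obtain ⟨P, Q, h⟩ := exists_isDiagonalization hr (extT_charpoly (f := f) (K := K))
  exact h.det_evalAt hr (AlgHom.id k K) aeval_extT x

lemma map_regRep (σ : Gal(K/k)) (x : K ⊗[k] AlgL f) :
    (regRep f K x).map σ = regRep f K (baseMap k (AlgL f) (σ : K →ₐ[k] K) x) := by
  refine (map_evalAt (σ : K →ₐ[k] K) _ _ ?_ x).symm
  ext i j
  simp [extT]

/-- The pair `(A₀ w², A₀ w² T₀)` for `w` in `K ⊗ L` with `N(w)² = f₀`. -/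
noncomputable def twistPair (hn : 0 < n) (w : K ⊗[k] AlgL f) : SymPair n K where
  A := extA f K hn * regRep f K (w * w)
  B := extA f K hn * regRep f K (w * w * (1 ⊗ₜ[k] AdjoinRoot.root (monicPoly f)))
  symmA := extA_mul_regRep_isSymm hn _
  symmB := extA_mul_regRep_isSymm hn _

lemma twistPair_A_mul_extT (hn : 0 < n) (w : K ⊗[k] AlgL f) :
    (twistPair hn w).A * extT f K = (twistPair hn w).B := by
  change extA f K hn * regRep f K (w * w) * extT f K = extA f K hn * regRep f K _
  rw [map_mul _ (w * w), mul_assoc]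
  congr 2
  exact (evalAt_root _ _).symm

/-- The operator is still multiplication by `β`, so only `det A` changes: it is multiplied by `N(w²)
= f₀`. -/
lemma twistPair_mem_fiber (hn : 0 < n) (hf : IsSplitForm f K) {w : K ⊗[k] AlgL f}
    (hw : Algebra.norm K w ^ 2 = algebraMap k K (f 0)) : twistPair hn w ∈ fiber f K := by
  refine mem_fiber_of_charpoly hf.lead_ne_zero (twistPair_A_mul_extT hn w) ?_ extT_charpoly
  have h := congrArg (algebraMap k K) (baseA_det f hn)
  rw [map_mul, map_pow, map_neg, map_one, RingHom.map_det] at h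
  change _ * (extA f K hn * regRep f K (w * w)).det = _
  rw [Matrix.det_mul, ← mul_assoc]
  refine (congrArg₂ (· * ·) h rfl).trans ?_
  rw [one_mul, det_regRep hf, map_mul, ← sq, hw]

/-- At this point `T` is multiplication by `β`, independent of `w`, so `p(β) ↦ p(T)` is the regular
representation and the cocycle can be computed inside `K ⊗ L`. -/
lemma evalT_twistPair (hn : 0 < n) (hf : IsSplitForm f K) {w : K ⊗[k] AlgL f}
    (hw : Algebra.norm K w ^ 2 = algebraMap k K (f 0)) (x : K ⊗[k] AlgL f) :
    evalT hf ⟨twistPair hn w, twistPair_mem_fiber hn hf hw⟩ (AlgHom.id k K) x =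
      regRep f K x := by
  have hA := hf.isUnit_det_A ⟨twistPair hn w, twistPair_mem_fiber hn hf hw⟩
  have hT : (twistPair hn w).T = extT f K :=
    ((Matrix.isUnit_iff_isUnit_det _).2 hA).mul_right_inj.1
      ((SymPair.A_mul_T hA).trans (twistPair_A_mul_extT hn w).symm)
  obtain ⟨p, rfl⟩ := evalBeta_surjective x
  rw [evalT_evalBeta, regRep, evalAt_evalBeta]
  exact congrArg (fun M => aeval M p) hT

/-- An element `y` of norm one with `σ(w²) = w² y²` carries `σ v` to `v`, where `v` is the pair
attached to `w`. -/
lemma regRep_smul_twistPair (hn : 0 < n) {w y : K ⊗[k] AlgL f} (σ : Gal(K/k))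
    (hy : baseMap k (AlgL f) (σ : K →ₐ[k] K) (w * w) = w * w * (y * y)) (g : SL n K)
    (hg : (g : Matrix (Fin n) (Fin n) K) = regRep f K y) :
    g • (twistPair hn w).map σ = twistPair hn w := by
  have key : ∀ x : K ⊗[k] AlgL f, (extA f K hn * regRep f K x).map σ =
      extA f K hn * regRep f K (baseMap k (AlgL f) (σ : K →ₐ[k] K) x) := by
    intro x
    rw [← map_regRep]
    refine (Matrix.map_mul (f := (σ : K →+* K))).trans ?_
    congr 1
    ext i j
    simp [extA]
  have key' : ∀ x : K ⊗[k] AlgL f, (regRep f K y).transpose * (extA f K hn * regRep f K x) *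
      regRep f K y = extA f K hn * regRep f K (x * (y * y)) := by
    intro x
    rw [← mul_assoc, transpose_regRep_mul, mul_assoc, mul_assoc, ← map_mul, ← map_mul]
    congr 2
    ring
  rw [SymPair.smul_eq_iff, hg]
  refine ⟨(key _).trans ?_, (key _).trans ?_⟩
  · rw [hy]
    exact (key' _).symm
  · rw [map_mul, hy]
    refine Eq.trans ?_ (key' _).symm
    congr 2
    simp only [baseMap, Algebra.TensorProduct.map_tmul, map_one, AlgHom.coe_id, id_eq]
    ring

/-! ### The obstruction class -/

lemma isObstructionClass_connecting [Algebra.IsIntegral k K] (hn : 0 < n)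
    (hf : IsSplitForm f K) (hex : IsShortExact Gal(K/k) (R0 k (AlgL f) K).subtype
      (normMu2 k (AlgL f) K)) (s : Kˣ)
    (hs : s ^ 2 = Units.map (algebraMap k K : k →* K) (Units.mk0 (f 0) hf.lead_ne_zero)) :
    IsObstructionClass (H2.map (R0.toDescStab hf) (R0.toDescStab_smul hf)
      (connecting hex (QuotientGroup.mk (kummerCocycle _ s hs)))) := by
  obtain ⟨sec, hsec⟩ := exists_norm_section hn hf
  set c := kummerCocycle _ s hs with hc
  set w : K ⊗[k] AlgL f := (sec s).1 with hw_def
  set w' : K ⊗[k] AlgL f := ((sec s)⁻¹).1 with hw'_def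
  have hww : w * w' = 1 := (sec s).mul_inv
  have hNw : Algebra.norm K w = s := hsec s
  have hNw' : Algebra.norm K w' = (s : K)⁻¹ := by
    rw [hw'_def, ← map_inv, hsec, Units.val_inv_eq_inv_val]
  have hw : Algebra.norm K w ^ 2 = algebraMap k K (f 0) := by
    rw [hNw]
    exact congrArg Units.val hs
  -- The very lift used in `connectingAux`, so that the two cocycles agree exactly and not only up
  -- to a coboundary.
  let B : Gal(K/k) → ResMu2 k (AlgL f) K := fun σ => Function.surjInv hex.surjective (c.1 σ)
  let b : Gal(K/k) → K ⊗[k] AlgL f := fun σ => (B σ).1.1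
  have hbb : ∀ σ, b σ * b σ = 1 := fun σ => by
    have h : (B σ).1 ^ 2 = 1 := (B σ).2
    have h' := congrArg Units.val h
    rwa [Units.val_pow_eq_pow_val, sq] at h'
  have hNb : ∀ σ, Algebra.norm K (b σ) = σ (s : K) * (s : K)⁻¹ := fun σ => by
    have h := congrArg (fun ζ : rootsOfUnity 2 K => (ζ.1 : K))
      (Function.surjInv_eq hex.surjective (c.1 σ))
    refine Eq.trans h ?_
    change ((Units.map (σ : K →* K) s / s : Kˣ) : K) = _
    rw [div_eq_mul_inv, Units.val_mul, Units.val_inv_eq_inv_val]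
    rfl
  let act : Gal(K/k) → K ⊗[k] AlgL f →ₐ[k] K ⊗[k] AlgL f :=
    fun σ => baseMap k (AlgL f) (σ : K →ₐ[k] K)
  have hact : ∀ σ τ x, act (σ * τ) x = act σ (act τ x) := fun σ τ x => by
    change baseMap k (AlgL f) ((σ : K →ₐ[k] K).comp (τ : K →ₐ[k] K)) x = _
    change _ = ((baseMap k (AlgL f) (σ : K →ₐ[k] K)).comp
      (baseMap k (AlgL f) (τ : K →ₐ[k] K))) x
    rw [← Algebra.TensorProduct.map_comp]
    rfl
  -- The factor `σ(w)/w` moves the conjugate pair back but has norm `σ(s)/s = ±1`; `b_σ` has the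
  -- same norm and square one, so it corrects the norm to `1` without changing `y_σ²`.
  let y : Gal(K/k) → K ⊗[k] AlgL f := fun σ => act σ w * w' * b σ
  have hNy : ∀ σ, (regRep f K (y σ)).det = 1 := fun σ => by
    have h1 : Algebra.norm K (act σ w) = σ (s : K) := by
      rw [← hNw]
      exact norm_baseMap (σ : K →ₐ[k] K) w
    have hs0 : (s : K) ≠ 0 := s.ne_zero
    have h2 : σ (s : K) ^ 2 = (s : K) ^ 2 := by
      have h3 : (s : K) ^ 2 = algebraMap k K (f 0) := congrArg Units.val hs
      rw [← map_pow, h3, AlgEquiv.commutes]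
    rw [det_regRep hf, map_mul, map_mul, h1, hNw', hNb]
    field_simp
    exact h2
  let g : Gal(K/k) → SL n K := fun σ => ⟨regRep f K (y σ), hNy σ⟩
  refine ⟨⟨twistPair hn w, twistPair_mem_fiber hn hf hw⟩, g,
    Z2.map _ (R0.toDescStab_smul hf) (connectingAux hex c), ?_, fun σ => ?_, fun σ τ => ?_, rfl⟩
  · rw [IsLocallyConstant.iff_eventually_eq]
    intro σ
    filter_upwards [(IsLocallyConstant.iff_eventually_eq _).1 (isLocallyConstant_baseMap w) σ,
      (IsLocallyConstant.iff_eventually_eq _).1 c.2.1 σ] with τ e1 e2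
    apply Subtype.ext
    change regRep f K (baseMap k (AlgL f) (τ : K →ₐ[k] K) w * w' *
      (Function.surjInv hex.surjective (c.1 τ)).1.1) = _
    rw [e1, e2]
  · apply Subtype.ext
    refine regRep_smul_twistPair hn (y := y σ) σ ?_ (g σ) rfl
    change act σ (w * w) = _
    rw [map_mul]
    calc act σ w * act σ w = act σ w * act σ w * ((w * w') * (w * w')) * (b σ * b σ) := by
          rw [hww, hbb, mul_one, mul_one, mul_one]
      _ = w * w * (y σ * y σ) := by
          simp only [y]
          ring
  · rw [eq_mul_inv_iff_mul_eq]
    apply Subtype.ext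
    set a := (connectingAux hex c).1 (σ, τ) with ha
    have hspec := connectingAux_spec hex c σ τ
    have hspec' : a.1 * B (σ * τ) = σ • B τ * B σ := by
      refine (congrArg (· * B (σ * τ)) hspec).trans ?_
      change σ • B τ / B (σ * τ) * B σ * B (σ * τ) = _
      rw [mul_right_comm, div_mul_cancel]
    have hab : (a.1.1 : K ⊗[k] AlgL f) * b (σ * τ) = act σ (b τ) * b σ :=
      congrArg (fun z : ResMu2 k (AlgL f) K => (z.1 : K ⊗[k] AlgL f)) hspec'
    change evalT hf ⟨twistPair hn w, _⟩ (AlgHom.id k K) (a.1.1 : K ⊗[k] AlgL f) *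
      regRep f K (y (σ * τ)) = regRep f K (y σ) * (regRep f K (y τ)).map σ
    rw [evalT_twistPair hn hf hw, map_regRep, ← map_mul, ← map_mul]
    congr 1
    have hσ : act σ w * act σ w' = 1 := by rw [← map_mul, hww, map_one]
    change a.1.1 * (act (σ * τ) w * w' * b (σ * τ)) =
      act σ w * w' * b σ * act σ (act τ w * w' * b τ)
    rw [map_mul, map_mul, ← hact]
    -- The factors `σ(w)/w` multiply as a coboundary and cancel, leaving the relation `hab` that
    -- defines the connecting cocycle.
    calc (a.1.1 : K ⊗[k] AlgL f) * (act (σ * τ) w * w' * b (σ * τ)) =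
          (a.1.1 * b (σ * τ)) * (act (σ * τ) w * w') * (act σ w * act σ w') := by
          rw [hσ, mul_one]
          ring
      _ = _ := by
          rw [hab]
          ring

end ObstructionClass

end PairsOfForms

/-! ### Assembly of the theorem. -/

open PairsOfForms in
theorem theorem3p5 {k : Type v} {K : Type u} [Field k] [Field K] [Algebra k K] [IsSepClosure k K]
    (h2 : (2 : k) ≠ 0) {n : ℕ} (hn : Even n) (hn0 : 0 < n)
    (f : Fin (n + 1) → k) (hf0 : f 0 ≠ 0) (hΔ : (dehomogenization f).discr ≠ 0) :
    -- the stabilizer schemes over `K` of the points `v ∈ V_f(K)`: isomorphisms on `E`-points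
    (∃ (ιG : ∀ (v : fiber f K) (E : Type u) [CommRing E] [Algebra k E] (φ : K →ₐ[k] E),
          R0 k (AlgL f) E ≃* MulAction.stabilizer (SL n E) (v.1.map φ))
        (ιH : ∀ (v : fiber f K) (E : Type u) [CommRing E] [Algebra k E] (φ : K →ₐ[k] E),
          R0modMu2 k (AlgL f) E ≃* MulAction.stabilizer (SLmodMu2 n E) (v.1.map φ)),
      -- `ιG` sends `p(β)` to `p(T)`, where `T = A⁻¹ B`
      (∀ (v : fiber f K) (E : Type u) [CommRing E] [Algebra k E] (φ : K →ₐ[k] E)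
        (x : R0 k (AlgL f) E) (p : Polynomial E),
        x.1.1.1 = evalBeta f p →
          ((ιG v E φ x).1 : Matrix (Fin n) (Fin n) E) = Polynomial.aeval (v.1.map φ).T p) ∧
      -- `ιH` is induced by `ιG` on the quotients by `μ₂`
      (∀ (v : fiber f K) (E : Type u) [CommRing E] [Algebra k E] (φ : K →ₐ[k] E)
        (x : R0 k (AlgL f) E),
        (ιH v E φ (QuotientGroup.mk x)).1 = QuotientGroup.mk (ιG v E φ x).1) ∧
      -- naturality in `E`; for `E = E' = K` and `ψ ∈ Gal(K/k)` this is Galois equivariance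
      (∀ (v : fiber f K) (E E' : Type u) [CommRing E] [Algebra k E] [CommRing E'] [Algebra k E']
        (φ : K →ₐ[k] E) (ψ : E →ₐ[k] E') (x : R0 k (AlgL f) E),
        (ιG v E' (ψ.comp φ) (R0.map ψ x)).1 =
          Matrix.SpecialLinearGroup.map (ψ : E →+* E') (ιG v E φ x).1) ∧
      -- the descended stabilizers `G_f` and `H_f`
      ∃ (ΦG : R0 k (AlgL f) K ≃* DescStab (SL n K) (fiber f K))
        (ΦH : R0modMu2 k (AlgL f) K ≃* DescStab (SLmodMu2 n K) (fiber f K))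
        (hΦG : ∀ (σ : Gal(K/k)) (x : R0 k (AlgL f) K), ΦG (σ • x) = σ • ΦG x),
        (∀ (σ : Gal(K/k)) (x : R0modMu2 k (AlgL f) K), ΦH (σ • x) = σ • ΦH x) ∧
        (∀ (x : R0 k (AlgL f) K) (v : fiber f K),
          (ΦG x).1 v = (ιG v K (AlgHom.id k K) x).1) ∧
        (∀ (x : R0modMu2 k (AlgL f) K) (v : fiber f K),
          (ΦH x).1 v = (ιH v K (AlgHom.id k K) x).1) ∧
        -- the obstruction classes
        ∃ (hex : IsShortExact Gal(K/k) (R0 k (AlgL f) K).subtype (normMu2 k (AlgL f) K))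
          (dG : H2 Gal(K/k) (DescStab (SL n K) (fiber f K)))
          (dH : H2 Gal(K/k) (DescStab (SLmodMu2 n K) (fiber f K))),
          (∀ d, IsObstructionClass d ↔ d = dG) ∧
          (∀ d, IsObstructionClass d ↔ d = dH) ∧
          H2.map ΦG.toMonoidHom hΦG (connecting hex (kummerClass K h2 (Units.mk0 (f 0) hf0))) = dG ∧
          H2.map (stabMap f K) (stabMap_smul f) dG = dH) := by
  have hsep : IsSepClosed K := IsSepClosure.sep_closed k
  have halg : Algebra.IsSeparable k K := IsSepClosure.separable
  have h2' : (2 : K) ≠ 0 := by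
    rw [← map_ofNat (algebraMap k K) 2]
    exact (map_ne_zero (algebraMap k K)).2 h2
  have hf : IsSplitForm f K := isSplitForm_of_discr_ne_zero hn0 hf0 hΔ
  have hex := isShortExact_norm (K := K) hn0 hf
  have hd := isObstructionClass_connecting hn0 hf hex _
    (exists_sqrt K h2 (Units.mk0 (f 0) hf0)).choose_spec
  -- The obstruction class comes with a point of the fiber, which the bijectivity of the two descent
  -- maps needs; `id` keeps `hd` available.
  obtain ⟨v₀, -⟩ := id hd
  have hG := hasDescent_SL hn0 h2' hf
  have hH := hasDescent_SLmodMu2 hn0 h2' hf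
  refine ⟨fun v E _ _ φ => stabEquivSL hf v φ, fun v E _ _ φ => stabEquivSLmodMu2 hf v φ,
    ?_, fun _ _ _ _ _ _ => rfl, fun v E E' _ _ _ _ φ ψ x => R0.toSL_map hf ψ rfl x,
    MulEquiv.ofBijective _ (R0.toDescStab_bijective hn0 h2' hf v₀),
    MulEquiv.ofBijective _ (R0modMu2.toDescStab_bijective hn0 h2' hf v₀),
    R0.toDescStab_smul hf, R0modMu2.toDescStab_smul hf, fun _ _ => rfl, fun _ _ => rfl,
    hex, _, _, fun d => ⟨fun h => hG.class_unique isLocallyConstant_smul_SL h hd, ?_⟩,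
    fun d => ⟨fun h => hH.class_unique isLocallyConstant_smul_SLmodMu2 h
      (hd.map (QuotientGroup.mk' (scalarMu2 n K)) (QuotientGroup.mk'_surjective _)
        (fun _ _ => rfl) fun _ _ => rfl), ?_⟩, rfl, rfl⟩
  · intro v E _ _ φ x p hx
    change evalT hf v φ (x.1.1 : E ⊗[k] AlgL f) = _
    rw [hx, evalT_evalBeta]
  · rintro rfl
    exact hd
  · rintro rfl
    exact hd.map (QuotientGroup.mk' (scalarMu2 n K)) (QuotientGroup.mk'_surjective _)
      (fun _ _ => rfl) fun _ _ => rfl
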